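/- Let $n\ge 2$ and $s\in(0,1)$; $B_r\subset\mathbb R^n$ is the open ball of radius $r$ centered at the origin. For a kernel $K:\mathbb R^n\setminus\{0\}\to[0,\infty)$, an open set $\Omega\subset\mathbb R^n$ and a (Lebesgue) measurable set $E\subset\mathbb R^n$ with complement $\mathcal C E$, let $$L_K(A,B)=\int_A\int_B K(x-\bar x)\,d\bar x\,dx,$$ $$P_{K,\Omega}(E)=L_K(E\cap\Omega,\mathcal C E\cap\Omega)+L_K(E\cap\Omega,\mathcal C E\setminus\Omega)+L_K(E\setminus\Omega,\mathcal C E\cap\Omega)\in[0,\infty].$$ The set $E$ is *stable* for $P_{K,\Omega}$ (stable for the $K$-perimeter in $\Omega$) if $P_{K,\Omega}(E)<\infty$ and, for every time-dependent vector field $X\in C^2_c(\Omega\times(-1,1);\mathbb R^n)$, with integral flow $\Psi_t$ (that is, $\Psi_0=\mathrm{id}$ and $\partial_t\Psi_t(x)=X(\Psi_t(x),t)$), and every $\varepsilon>0$, there is $t_0>0$ such that for all $t\in(-t_0,t_0)$, with $F_t=\Psi_t(E)$, $$0\le P_{K,\Omega}(F_t\cup E)-P_{K,\Omega}(E)+\varepsilon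 t^2\quad\text{and}\quad 0\le P_{K,\Omega}(F_t\cap E)-P_{K,\Omega}(E)+\varepsilon t^2 .$$ For $\lambda>0$ and $\Lambda\in\mathbb R$, the class $\mathcal L_2(s,\lambda,\Lambda)$ consists of the even kernels $K$ whose directional derivatives $\partial_eK$, $\partial_{ee}K$ exist off the origin and which satisfy $$\frac{\lambda}{|z|^{n+s}}\le K(z)\le\frac{\Lambda}{|z|^{n+s}},\qquad \max\bigl\{|z|\,|\partial_eK(z)|,\ |z|^2\,|\partial_{ee}K(z)|\bigr\}\le\frac{\Lambda}{|z|^{n+s}}$$ for all $z\in\mathbb R^n\setminus\{0\}$ and all unit vectors $e$. The classical perimeter of $E$ in $\Omega$ is $$\mathrm{Per}_\Omega(E)=|\nabla\chi_E|(\Omega)=\sup\Bigl\{\int_\Omega\chi_E\,\mathrm{div}\,\phi\,dx:\ \phi\in C^1_c(\Omega;\mathbb R^n),\ |\phi|\le1\Bigr\}\in[0,\infty].$$ **(a)** For all $\lambda>0$ and $\Lambda$ there is a constant $C=C(n,s,\lambda,\Lambda)>0$ such that for every $K\in\mathcal L_2(s,\lambda,\Lambda)$, every $R>0$ and every measurable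 set $E$ that is stable for the $K$-perimeter in $B_{4R}$, $$\mathrm{Per}_{B_R}(E)\le C\,R^{n-1}\qquad\text{and}\qquad P_{K,B_R}(E)\le C\,R^{n-s}.$$ **(b)** There is a constant $C=C(n,s)>0$ such that for every $R>0$ and every measurable set $E$ that is stable in $B_{2R}$ for the fractional $s$-perimeter, i.e. for the kernel $K_s(z)=|z|^{-n-s}$, $$\mathrm{Per}_{B_R}(E)\le C\,R^{n-1}\qquad\text{and}\qquad P_{K_s,B_R}(E)\le C\,R^{n-s}.$$ -/

import Mathlib

open MeasureTheory Set

/-- The interaction `L_K(A, B) = ∫_A ∫_B K(x - y) dy dx`, with values in `[0, ∞]`. -/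
noncomputable def kernelInteraction {n : ℕ} (K : EuclideanSpace ℝ (Fin n) → ℝ)
    (A B : Set (EuclideanSpace ℝ (Fin n))) : ENNReal :=
  ∫⁻ x in A, ∫⁻ y in B, ENNReal.ofReal (K (x - y))

/-- The `K`-perimeter of `E` inside `Ω`:
`P_{K,Ω}(E) = L_K(E ∩ Ω, Eᶜ ∩ Ω) + L_K(E ∩ Ω, Eᶜ \ Ω) + L_K(E \ Ω, Eᶜ ∩ Ω)`. -/
noncomputable def kernelPerimeter {n : ℕ} (K : EuclideanSpace ℝ (Fin n) → ℝ)
    (Ω E : Set (EuclideanSpace ℝ (Fin n))) : ENNReal :=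
  kernelInteraction K (E ∩ Ω) (Eᶜ ∩ Ω) + kernelInteraction K (E ∩ Ω) (Eᶜ \ Ω)
    + kernelInteraction K (E \ Ω) (Eᶜ ∩ Ω)

/-- `X ∈ C²_c(Ω × (-1, 1); ℝⁿ)`: a time-dependent vector field, extended by zero. -/
structure IsAdmissibleField {n : ℕ} (Ω : Set (EuclideanSpace ℝ (Fin n)))
    (X : EuclideanSpace ℝ (Fin n) × ℝ → EuclideanSpace ℝ (Fin n)) : Prop where
  contDiff : ContDiff ℝ 2 X
  hasCompactSupport : HasCompactSupport X
  tsupport_subset : tsupport X ⊆ Ω ×ˢ Ioo (-1 : ℝ) 1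

/-- `Ψ` is the integral flow of the time-dependent field `X`:
`Ψ_0 = id` and `∂_t Ψ_t(x) = X(Ψ_t(x), t)`. -/
structure IsIntegralFlow {n : ℕ}
    (X : EuclideanSpace ℝ (Fin n) × ℝ → EuclideanSpace ℝ (Fin n))
    (Ψ : ℝ → EuclideanSpace ℝ (Fin n) → EuclideanSpace ℝ (Fin n)) : Prop where
  initial : ∀ x, Ψ 0 x = x
  hasDerivAt : ∀ x t, HasDerivAt (fun τ : ℝ => Ψ τ x) (X (Ψ t x, t)) t

/-- `E` is a stable set for `P_{K,Ω}`. The inequalities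
`0 ≤ P_{K,Ω}(F_t ∪ E) - P_{K,Ω}(E) + ε t²` and `0 ≤ P_{K,Ω}(F_t ∩ E) - P_{K,Ω}(E) + ε t²`,
where `F_t = Ψ_t(E)`, are written without subtraction; `P_{K,Ω}(E)` is finite. -/
structure IsStableSet {n : ℕ} (K : EuclideanSpace ℝ (Fin n) → ℝ)
    (Ω E : Set (EuclideanSpace ℝ (Fin n))) : Prop where
  finite : kernelPerimeter K Ω E < ⊤
  stable : ∀ X : EuclideanSpace ℝ (Fin n) × ℝ → EuclideanSpace ℝ (Fin n),
    IsAdmissibleField Ω X →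
    ∀ Ψ : ℝ → EuclideanSpace ℝ (Fin n) → EuclideanSpace ℝ (Fin n), IsIntegralFlow X Ψ →
    ∀ ε : ℝ, 0 < ε → ∃ t₀ : ℝ, 0 < t₀ ∧ ∀ t ∈ Ioo (-t₀) t₀,
      kernelPerimeter K Ω E
          ≤ kernelPerimeter K Ω ((Ψ t '' E) ∪ E) + ENNReal.ofReal (ε * t ^ 2) ∧
      kernelPerimeter K Ω E
          ≤ kernelPerimeter K Ω ((Ψ t '' E) ∩ E) + ENNReal.ofReal (ε * t ^ 2)

/-- The class `𝓛₂(s, lam, Lam)` of kernels on `ℝⁿ`. The only regularity required is that the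
directional derivatives `∂_e K` and `∂_{ee} K`, which the bounds speak of, exist off the
origin. -/
structure IsKernelL2 {n : ℕ} (s lam Lam : ℝ) (K : EuclideanSpace ℝ (Fin n) → ℝ) : Prop where
  even : ∀ z, K z = K (-z)
  lower : ∀ z, z ≠ 0 → lam / ‖z‖ ^ ((n : ℝ) + s) ≤ K z
  upper : ∀ z, z ≠ 0 → K z ≤ Lam / ‖z‖ ^ ((n : ℝ) + s)
  lineDifferentiable : ∀ z, z ≠ 0 → ∀ e, ‖e‖ = 1 → LineDifferentiableAt ℝ K z e
  lineDifferentiable₂ : ∀ z, z ≠ 0 → ∀ e, ‖e‖ = 1 →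
    LineDifferentiableAt ℝ (fun y => lineDeriv ℝ K y e) z e
  bound : ∀ z, z ≠ 0 → ∀ e, ‖e‖ = 1 →
    max (‖z‖ * |lineDeriv ℝ K z e|)
        (‖z‖ ^ 2 * |lineDeriv ℝ (fun y => lineDeriv ℝ K y e) z e|)
      ≤ Lam / ‖z‖ ^ ((n : ℝ) + s)

/-- The kernel `|z|^{-(n+s)}` of the fractional `s`-perimeter. -/
noncomputable def fractionalKernel (n : ℕ) (s : ℝ) (z : EuclideanSpace ℝ (Fin n)) : ℝ :=
  1 / ‖z‖ ^ ((n : ℝ) + s)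

/-- The divergence of a vector field on `ℝⁿ`. -/
noncomputable def vectorDivergence {n : ℕ}
    (φ : EuclideanSpace ℝ (Fin n) → EuclideanSpace ℝ (Fin n))
    (x : EuclideanSpace ℝ (Fin n)) : ℝ :=
  ∑ i : Fin n, (fderiv ℝ φ x (EuclideanSpace.single i 1)) i

/-- `φ ∈ C¹_c(Ω; ℝⁿ)` with `|φ| ≤ 1`. -/
structure IsVariationTest {n : ℕ} (Ω : Set (EuclideanSpace ℝ (Fin n)))
    (φ : EuclideanSpace ℝ (Fin n) → EuclideanSpace ℝ (Fin n)) : Prop where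
  contDiff : ContDiff ℝ 1 φ
  hasCompactSupport : HasCompactSupport φ
  tsupport_subset : tsupport φ ⊆ Ω
  norm_le_one : ∀ x, ‖φ x‖ ≤ 1

/-- The total variation `|∇u|(Ω) = sup { ∫_Ω u div φ : φ ∈ C¹_c(Ω; ℝⁿ), |φ| ≤ 1 } ∈ [0, ∞]`.
The supremum is nonnegative (take `φ = 0`), so negative values may be truncated to `0`. -/
noncomputable def totalVariationOn {n : ℕ} (u : EuclideanSpace ℝ (Fin n) → ℝ)
    (Ω : Set (EuclideanSpace ℝ (Fin n))) : ENNReal :=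
  ⨆ φ : {φ : EuclideanSpace ℝ (Fin n) → EuclideanSpace ℝ (Fin n) // IsVariationTest Ω φ},
    ENNReal.ofReal (∫ x in Ω, u x * vectorDivergence φ.1 x)

/-- The classical perimeter `Per_Ω(E) = |∇χ_E|(Ω)` of `E` in `Ω`. -/
noncomputable def classicalPerimeter {n : ℕ} (Ω E : Set (EuclideanSpace ℝ (Fin n))) : ENNReal :=
  totalVariationOn (E.indicator fun _ => (1 : ℝ)) Ω

/-! ### Kernels of class `𝓛₂` -/

section Kernel

variable {n : ℕ}

/-! The proof compares `E` with its images `F` and `F'` under the almost-translations `x ↦ x ± t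
g(x) e`, where `e` is a unit vector and `g` is a cutoff equal to `1` near `B_ρ(x₀)` and supported in
`B = B_{3ρ/2}(x₀)`. Changing variables back to `E` and symmetrising in `±t`, the first-order terms
cancel; the bounds on two derivatives of `K` leave `P(F) + P(F') ≤ 2 P(E) + C (t/ρ)² P_B(E)`
(`kernelPerimeter_deformation_add_le`).

The nonlocal perimeter is submodular with a defect: `P(F ∪ E) + P(F ∩ E)` falls short of `P(F) +
P(E)` by at least the interaction of `F \ E` with `E \ F` inside `B`. Stability bounds the
perimeters of unions and intersections below, up to `o(t²)`, so this interaction is at most `C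
(t/ρ)² P_B(E) + o(t²)`. As `K ≥ c ρ^{-n-s}` on the ball, the product of the gained and lost volumes
in `B_ρ` is at most `C t² ρ^{n+s-2} P_B(E) + o(t²)`. Their difference is a pure boundary effect of a
translation, at most `C t ρ^{n-1}`. A small product and a small difference bound the sum: this is
`exists_volume_shiftDiff_le`, a BV estimate of the form `Per_{B_ρ} ≤ C ρ^{n-1} + C √(ρ^{n+s-2}
P_B(E))`.

The square root closes the loop. Small translations can be iterated, so the estimate holds for
finite ones. Writing the energy as `∫ K(z) |{χ_E ≠ χ_{E+z}}| dz`, the Lipschitz bound in `z` serves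
for small `z` (where `s < 1` is needed), and the trivial volume bound for large `z` (where `s > 0`
is needed). Young's inequality then bounds the energy in `B_{ρ/2}` by `C (1 + 1/η) ρ^{n-s}` plus `η`
times the energy in `B_{3ρ/2}`, for every `η > 0` (`exists_energy_ball_le`). Since the energy is a
finite measure on the large ball, averaging over all balls with radius proportional to the distance
to the boundary absorbs the last term (`exists_absorption`). The resulting bound `C R^{n-s}`, put
back into the BV estimate, gives the classical perimeter bound. The fractional kernel belongs to the
class, so both parts follow from `exists_perimeter_bounds`. -/

theorem LineDifferentiableAt.hasDerivAt_comp_line {E : Type*} [NormedAddCommGroup E]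
    [NormedSpace ℝ E] {F : E → ℝ} {z e ω : E} {r τ : ℝ} (hω : ω = r • e)
    (h : LineDifferentiableAt ℝ F (z + τ • ω) e) :
    HasDerivAt (fun σ : ℝ => F (z + σ • ω)) (r * lineDeriv ℝ F (z + τ • ω) e) τ := by
  have h1 : HasDerivAt (fun t : ℝ => F ((z + τ • ω) + t • e))
      (lineDeriv ℝ F (z + τ • ω) e) (r * (τ - τ)) := by
    rw [sub_self, mul_zero]; exact h.hasLineDerivAt
  have h2 : HasDerivAt (fun σ : ℝ => r * (σ - τ)) r τ := by
    simpa using ((hasDerivAt_id τ).sub_const τ).const_mul r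
  have h3 := h1.comp τ h2
  rw [mul_comm]
  refine h3.congr_of_eventuallyEq (Filter.Eventually.of_forall fun σ => ?_)
  simp only [Function.comp, hω]
  congr 1
  module

theorem le_norm_add_smul {E : Type*} [NormedAddCommGroup E] [NormedSpace ℝ E] {z ω : E} {q τ : ℝ}
    (hq : q ≤ 1 / 2) (hω : ‖ω‖ ≤ q * ‖z‖) (hτ : |τ| ≤ 1) : ‖z‖ / 2 ≤ ‖z + τ • ω‖ := by
  have h1 : ‖τ • ω‖ ≤ ‖z‖ / 2 := by
    rw [norm_smul, Real.norm_eq_abs]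
    nlinarith [norm_nonneg ω, norm_nonneg z, abs_nonneg τ]
  have h2 := norm_sub_norm_le z (-(τ • ω))
  rw [norm_neg, sub_neg_eq_add] at h2
  linarith

namespace IsKernelL2

variable {s lam Lam : ℝ} {K : EuclideanSpace ℝ (Fin n) → ℝ}

theorem lam_le_Lam (hK : IsKernelL2 s lam Lam K) {z : EuclideanSpace ℝ (Fin n)} (hz : z ≠ 0) :
    lam ≤ Lam := by
  have h := (hK.lower z hz).trans (hK.upper z hz)
  have hp : 0 < ‖z‖ ^ ((n : ℝ) + s) := Real.rpow_pos_of_pos (norm_pos_iff.2 hz) _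
  exact (div_le_div_iff_of_pos_right hp).1 h

theorem nonneg (hK : IsKernelL2 s lam Lam K) (hl : 0 < lam) {z : EuclideanSpace ℝ (Fin n)}
    (hz : z ≠ 0) : 0 ≤ K z :=
  le_trans (by positivity) (hK.lower z hz)

/-- Bounds for `K` and its directional derivatives at points of norm at least `d`. -/
theorem bounds_of_le_norm (hK : IsKernelL2 s lam Lam K) (hs : 0 < s) (hl : 0 < lam) {d : ℝ}
    (hd : 0 < d) {w e : EuclideanSpace ℝ (Fin n)} (hw : d ≤ ‖w‖) (he : ‖e‖ = 1) :
    K w ≤ Lam / d ^ ((n : ℝ) + s) ∧ |lineDeriv ℝ K w e| ≤ Lam / d ^ ((n : ℝ) + s) / d ∧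
      |lineDeriv ℝ (fun y => lineDeriv ℝ K y e) w e| ≤ Lam / d ^ ((n : ℝ) + s) / d ^ 2 := by
  have hw0 : w ≠ 0 := norm_pos_iff.1 (hd.trans_le hw)
  have hL : 0 < Lam := hl.trans_le (hK.lam_le_Lam hw0)
  have hp : 0 ≤ (n : ℝ) + s := by positivity
  have h1 : Lam / ‖w‖ ^ ((n : ℝ) + s) ≤ Lam / d ^ ((n : ℝ) + s) := by gcongr
  have h2 := (hK.bound w hw0 e he).trans h1
  have h3 := (le_max_left _ _).trans h2
  have h4 := (le_max_right _ _).trans h2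
  refine ⟨(hK.upper w hw0).trans h1, ?_, ?_⟩
  · rw [le_div_iff₀ hd]
    nlinarith [abs_nonneg (lineDeriv ℝ K w e)]
  · rw [le_div_iff₀ (by positivity)]
    have : d ^ 2 ≤ ‖w‖ ^ 2 := by gcongr
    nlinarith [abs_nonneg (lineDeriv ℝ (fun y => lineDeriv ℝ K y e) w e)]

/-- First and second differences of a kernel along a segment that avoids the origin. -/
theorem differences (hK : IsKernelL2 s lam Lam K) (hs : 0 < s) (hl : 0 < lam)
    {z ω : EuclideanSpace ℝ (Fin n)} (hz : z ≠ 0) {q : ℝ} (hq : q ≤ 1 / 2)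
    (hω : ‖ω‖ ≤ q * ‖z‖) :
    |K (z + ω) - K z| ≤ 2 * q * (Lam / (‖z‖ / 2) ^ ((n : ℝ) + s)) ∧
    |K (z + ω) - K (z - ω)| ≤ 4 * q * (Lam / (‖z‖ / 2) ^ ((n : ℝ) + s)) ∧
      |K (z + ω) + K (z - ω) - 2 * K z| ≤
        8 * q ^ 2 * (Lam / (‖z‖ / 2) ^ ((n : ℝ) + s)) := by
  set A := Lam / (‖z‖ / 2) ^ ((n : ℝ) + s) with hA
  have hz' : 0 < ‖z‖ := norm_pos_iff.2 hz
  have hL : 0 < Lam := hl.trans_le (hK.lam_le_Lam hz)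
  have hA0 : 0 < A := by positivity
  rcases eq_or_ne ω 0 with rfl | hω0
  -- With `ω = 0` there is no unit direction to differentiate in.
  · have hq0 : 0 ≤ q := by
      rw [norm_zero] at hω; exact nonneg_of_mul_nonneg_left hω hz'
    have h0 : K z + K z - 2 * K z = 0 := by ring
    simp only [add_zero, sub_zero, sub_self, abs_zero, h0]
    exact ⟨by positivity, by positivity, by positivity⟩
  have hr : 0 < ‖ω‖ := norm_pos_iff.2 hω0
  set e : EuclideanSpace ℝ (Fin n) := ‖ω‖⁻¹ • ω with he_def
  have he : ‖e‖ = 1 := by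
    rw [he_def, norm_smul, norm_inv, norm_norm, inv_mul_cancel₀ hr.ne']
  have hωe : ω = ‖ω‖ • e := by rw [he_def, smul_smul, mul_inv_cancel₀ hr.ne', one_smul]
  have hq0 : 0 ≤ q := nonneg_of_mul_nonneg_left ((norm_nonneg ω).trans hω) hz'
  have hd : 0 < ‖z‖ / 2 := by positivity
  have hfar : ∀ τ ∈ Icc (-1 : ℝ) 1, ‖z‖ / 2 ≤ ‖z + τ • ω‖ := fun τ hτ =>
    le_norm_add_smul hq hω (abs_le.2 hτ)
  have hne : ∀ τ ∈ Icc (-1 : ℝ) 1, z + τ • ω ≠ 0 := fun τ hτ =>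
    norm_pos_iff.1 (hd.trans_le (hfar τ hτ))
  set f : ℝ → ℝ := fun τ => K (z + τ • ω) with hf
  set f1 : ℝ → ℝ := fun τ => ‖ω‖ * lineDeriv ℝ K (z + τ • ω) e with hf1
  set f2 : ℝ → ℝ := fun τ =>
    ‖ω‖ * (‖ω‖ * lineDeriv ℝ (fun y => lineDeriv ℝ K y e) (z + τ • ω) e) with hf2
  have hdf : ∀ τ ∈ Icc (-1 : ℝ) 1, HasDerivAt f (f1 τ) τ := fun τ hτ =>
    (hK.lineDifferentiable _ (hne τ hτ) e he).hasDerivAt_comp_line hωe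
  have hdf1 : ∀ τ ∈ Icc (-1 : ℝ) 1, HasDerivAt f1 (f2 τ) τ := fun τ hτ =>
    ((hK.lineDifferentiable₂ _ (hne τ hτ) e he).hasDerivAt_comp_line hωe).const_mul _
  have hb1 : ∀ τ ∈ Icc (-1 : ℝ) 1, ‖f1 τ‖ ≤ 2 * q * A := fun τ hτ => by
    have h := (hK.bounds_of_le_norm hs hl hd (hfar τ hτ) he).2.1
    rw [Real.norm_eq_abs, hf1, abs_mul, abs_of_pos hr]
    calc ‖ω‖ * |lineDeriv ℝ K (z + τ • ω) e| ≤ (q * ‖z‖) * (A / (‖z‖ / 2)) := by gcongr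
      _ = 2 * q * A := by field_simp
  have hb2 : ∀ τ ∈ Icc (-1 : ℝ) 1, ‖f2 τ‖ ≤ 4 * q ^ 2 * A := fun τ hτ => by
    have h := (hK.bounds_of_le_norm hs hl hd (hfar τ hτ) he).2.2
    rw [Real.norm_eq_abs, hf2, abs_mul, abs_mul, abs_of_pos hr]
    calc ‖ω‖ * (‖ω‖ * |lineDeriv ℝ (fun y => lineDeriv ℝ K y e) (z + τ • ω) e|)
        ≤ (q * ‖z‖) * ((q * ‖z‖) * (A / (‖z‖ / 2) ^ 2)) := by gcongr
      _ = 4 * q ^ 2 * A := by field_simp; ring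
  have m1 : (1 : ℝ) ∈ Icc (-1 : ℝ) 1 := by norm_num
  have m0 : (0 : ℝ) ∈ Icc (-1 : ℝ) 1 := by norm_num
  have mm : (-1 : ℝ) ∈ Icc (-1 : ℝ) 1 := by norm_num
  have e1 : f 1 = K (z + ω) := by simp [hf]
  have e0 : f 0 = K z := by simp [hf]
  have em : f (-1) = K (z - ω) := by simp [hf, sub_eq_add_neg]
  have hlip : ∀ x ∈ Icc (-1 : ℝ) 1, ∀ y ∈ Icc (-1 : ℝ) 1, ‖f y - f x‖ ≤ 2 * q * A * ‖y - x‖ :=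
    fun x hx y hy => (convex_Icc (-1 : ℝ) 1).norm_image_sub_le_of_norm_hasDerivWithin_le
      (fun τ hτ => (hdf τ hτ).hasDerivWithinAt) hb1 hx hy
  have hlip1 : ∀ x ∈ Icc (-1 : ℝ) 1, ∀ y ∈ Icc (-1 : ℝ) 1,
      ‖f1 y - f1 x‖ ≤ 4 * q ^ 2 * A * ‖y - x‖ :=
    fun x hx y hy => (convex_Icc (-1 : ℝ) 1).norm_image_sub_le_of_norm_hasDerivWithin_le
      (fun τ hτ => (hdf1 τ hτ).hasDerivWithinAt) hb2 hx hy
  have neg_mem : ∀ τ ∈ Icc (0 : ℝ) 1, -τ ∈ Icc (-1 : ℝ) 1 := fun τ hτ =>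
    ⟨by linarith [hτ.2], by linarith [hτ.1]⟩
  have pos_mem : ∀ τ ∈ Icc (0 : ℝ) 1, τ ∈ Icc (-1 : ℝ) 1 := fun τ hτ =>
    ⟨by linarith [hτ.1], hτ.2⟩
  -- The mean value inequality is applied to the even part `f τ + f (-τ)`, whose derivative `f1 τ -
  -- f1 (-τ)` is controlled by the Lipschitz bound for `f1`. Thus no continuity of the second
  -- derivative is used.
  have hg : ‖(f 1 + f (-1)) - (f 0 + f (-0))‖ ≤ 8 * q ^ 2 * A * ‖(1 : ℝ) - 0‖ := by
    refine (convex_Icc (0 : ℝ) 1).norm_image_sub_le_of_norm_hasDerivWithin_le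
      (f := fun τ => f τ + f (-τ)) (f' := fun τ => f1 τ - f1 (-τ)) (fun τ hτ => ?_)
      (fun τ hτ => ?_) (by norm_num) (by norm_num)
    · have h1 := hdf τ (pos_mem τ hτ)
      have h2 := (hdf (-τ) (neg_mem τ hτ)).comp τ (hasDerivAt_neg τ)
      have h3 := h1.add h2
      rw [mul_neg_one, ← sub_eq_add_neg] at h3
      exact h3.hasDerivWithinAt
    · refine (hlip1 _ (neg_mem τ hτ) _ (pos_mem τ hτ)).trans ?_
      have : ‖τ - -τ‖ ≤ 2 := by
        rw [Real.norm_eq_abs, abs_le]; constructor <;> linarith [hτ.1, hτ.2]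
      nlinarith [mul_nonneg (sq_nonneg q) hA0.le]
  refine ⟨?_, ?_, ?_⟩
  · have h := hlip 0 m0 1 m1
    rw [e1, e0, Real.norm_eq_abs] at h
    simpa using h
  · have h := hlip (-1) mm 1 m1
    rw [e1, em, Real.norm_eq_abs] at h
    refine h.trans (le_of_eq ?_)
    norm_num
    ring
  · rw [neg_zero, e1, em, e0, Real.norm_eq_abs, sub_zero, norm_one, mul_one] at hg
    rwa [two_mul]

/-- Directional differentiability alone does not give continuity; here it follows because the first
difference bound is uniform over directions. -/
theorem continuousAt (hK : IsKernelL2 s lam Lam K) (hs : 0 < s) (hl : 0 < lam)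
    {z : EuclideanSpace ℝ (Fin n)} (hz : z ≠ 0) : ContinuousAt K z := by
  have hz' : 0 < ‖z‖ := norm_pos_iff.2 hz
  set A := Lam / (‖z‖ / 2) ^ ((n : ℝ) + s)
  rw [ContinuousAt, tendsto_iff_norm_sub_tendsto_zero]
  refine squeeze_zero' (g := fun w => 2 * (‖w - z‖ / ‖z‖) * A)
    (Filter.Eventually.of_forall fun _ => norm_nonneg _) ?_ ?_
  · filter_upwards [Metric.ball_mem_nhds z (half_pos hz')] with w hw
    rw [Metric.mem_ball, dist_eq_norm] at hw
    have h := (hK.differences hs hl hz (ω := w - z) (q := ‖w - z‖ / ‖z‖)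
      (by rw [div_le_iff₀ hz']; linarith) (by rw [div_mul_cancel₀ _ hz'.ne'])).1
    rwa [add_sub_cancel] at h
  · have : Continuous fun w : EuclideanSpace ℝ (Fin n) => 2 * (‖w - z‖ / ‖z‖) * A := by
      fun_prop
    simpa using this.tendsto z

theorem measurable (hK : IsKernelL2 s lam Lam K) (hs : 0 < s) (hl : 0 < lam) : Measurable K := by
  have hc : ContinuousOn K {0}ᶜ := fun z hz => (hK.continuousAt hs hl hz).continuousWithinAt
  refine measurable_of_restrict_of_restrict_compl (measurableSet_singleton 0) ?_ ?_
  · exact Subsingleton.measurable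
  · exact (continuousOn_iff_continuous_domRestrict.1 hc).measurable

/-- The pointwise second variation estimate. -/
theorem second_variation (hK : IsKernelL2 s lam Lam K) (hs : 0 < s) (hl : 0 < lam)
    {z ω : EuclideanSpace ℝ (Fin n)} (hz : z ≠ 0) {q a b : ℝ} (hq : q ≤ 1 / 2)
    (hω : ‖ω‖ ≤ q * ‖z‖) (ha : |a| ≤ q) (hb : |b| ≤ q) :
    K (z + ω) * ((1 + a) * (1 + b)) + K (z - ω) * ((1 - a) * (1 - b)) ≤
      (2 + 18 * (2 ^ ((n : ℝ) + s) * Lam / lam) * q ^ 2) * K z := by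
  obtain ⟨-, h1, h2⟩ := hK.differences hs hl hz hq hω
  have hz' : 0 < ‖z‖ := norm_pos_iff.2 hz
  have hd : 0 < ‖z‖ / 2 := by positivity
  have hL : 0 < Lam := hl.trans_le (hK.lam_le_Lam hz)
  obtain ⟨e, he⟩ : ∃ e : EuclideanSpace ℝ (Fin n), ‖e‖ = 1 :=
    ⟨‖z‖⁻¹ • z, by rw [norm_smul, norm_inv, norm_norm, inv_mul_cancel₀ hz'.ne']⟩
  have hp := (hK.bounds_of_le_norm hs hl hd
    (le_norm_add_smul hq hω (τ := 1) (by norm_num)) he).1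
  have hm := (hK.bounds_of_le_norm hs hl hd
    (le_norm_add_smul hq hω (τ := -1) (by norm_num)) he).1
  rw [one_smul] at hp
  rw [neg_one_smul, ← sub_eq_add_neg] at hm
  set A := Lam / (‖z‖ / 2) ^ ((n : ℝ) + s) with hA
  have hA0 : 0 < A := by positivity
  -- The lower bound on `K` turns the power-law error into a multiple of `K z` itself, so that after
  -- integration the error is again a perimeter.
  have hAK : A ≤ 2 ^ ((n : ℝ) + s) * Lam / lam * K z := by
    refine le_trans (le_of_eq ?_) (mul_le_mul_of_nonneg_left (hK.lower z hz) (by positivity))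
    rw [hA, Real.div_rpow hz'.le (by norm_num)]
    field_simp
  have hq0 : 0 ≤ q := (abs_nonneg a).trans ha
  have hKp : 0 ≤ K (z + ω) := by
    refine hK.nonneg hl (norm_pos_iff.1 (hd.trans_le ?_))
    simpa using le_norm_add_smul hq hω (τ := 1) (by norm_num)
  have hKm : 0 ≤ K (z - ω) := by
    refine hK.nonneg hl (norm_pos_iff.1 (hd.trans_le ?_))
    simpa [sub_eq_add_neg] using le_norm_add_smul hq hω (τ := -1) (by norm_num)
  have hab : |a + b| ≤ 2 * q := (abs_add_le a b).trans (by linarith)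
  -- After symmetrisation each remaining term is a product of two small factors or a second
  -- difference, hence of order `q²`.
  have t1 : (a + b) * (K (z + ω) - K (z - ω)) ≤ 2 * q * (4 * q * A) := by
    refine (le_abs_self _).trans ?_
    rw [abs_mul]
    gcongr
  have t2 : a * b * (K (z + ω) + K (z - ω)) ≤ q * q * (A + A) := by
    have : a * b ≤ q * q := by
      refine (le_abs_self _).trans ?_
      rw [abs_mul]; gcongr
    gcongr
  have t3 := (le_abs_self _).trans h2
  calc K (z + ω) * ((1 + a) * (1 + b)) + K (z - ω) * ((1 - a) * (1 - b))
      = (K (z + ω) + K (z - ω) - 2 * K z) + (a + b) * (K (z + ω) - K (z - ω))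
        + a * b * (K (z + ω) + K (z - ω)) + 2 * K z := by ring
    _ ≤ 8 * q ^ 2 * A + 2 * q * (4 * q * A) + q * q * (A + A) + 2 * K z := by gcongr
    _ = 18 * q ^ 2 * A + 2 * K z := by ring
    _ ≤ 18 * q ^ 2 * (2 ^ ((n : ℝ) + s) * Lam / lam * K z) + 2 * K z := by gcongr
    _ = _ := by ring

end IsKernelL2

end Kernel

/-! ### Deformations realised by integral flows -/

section Flow

open scoped ContDiff NNReal

section Perturbation

variable {W : Type*} [NormedAddCommGroup W] [NormedSpace ℝ W]

theorem LipschitzWith.approximatesLinearOn_id_add {γ : W → W} {c : ℝ≥0} (hγ : LipschitzWith c γ) :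
    ApproximatesLinearOn (fun x => x + γ x)
      ((ContinuousLinearEquiv.refl ℝ W : W ≃L[ℝ] W) : W →L[ℝ] W) univ c := by
  intro x _ y _
  have h := hγ.dist_le_mul x y
  rw [dist_eq_norm, dist_eq_norm] at h
  refine le_trans (le_of_eq ?_) h
  congr 1
  simp only [ContinuousLinearEquiv.coe_coe, ContinuousLinearEquiv.refl_apply]
  abel

/-- A perturbation of the identity by a map with Lipschitz constant less than `1`. -/
noncomputable def LipschitzWith.idAddHomeomorph [CompleteSpace W] {γ : W → W} {c : ℝ≥0}
    (hγ : LipschitzWith c γ) (hc : c < 1) : W ≃ₜ W :=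
  hγ.approximatesLinearOn_id_add.toHomeomorph _ (by
    rcases subsingleton_or_nontrivial W with h | h
    · exact Or.inl h
    · right
      have : ‖((ContinuousLinearEquiv.refl ℝ W).symm : W →L[ℝ] W)‖₊ = 1 := by
        rw [ContinuousLinearEquiv.refl_symm, ContinuousLinearEquiv.coe_refl]
        exact NNReal.eq ContinuousLinearMap.norm_id
      rw [this, inv_one]; exact hc)

@[simp]
theorem LipschitzWith.idAddHomeomorph_apply [CompleteSpace W] {γ : W → W} {c : ℝ≥0}
    (hγ : LipschitzWith c γ) (hc : c < 1) (x : W) : hγ.idAddHomeomorph hc x = x + γ x := rfl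

/-- The derivative of `γ` has norm at most `c < 1`, so the Neumann series inverts the identity plus
it. -/
theorem LipschitzWith.exists_hasFDerivAt_id_add [CompleteSpace W] {γ : W → W} {c : ℝ≥0}
    (hγ : LipschitzWith c γ) (hc : c < 1) (hd : Differentiable ℝ γ) (x : W) :
    ∃ A : W ≃L[ℝ] W, HasFDerivAt (fun x => x + γ x) (A : W →L[ℝ] W) x := by
  have hn : ‖-fderiv ℝ γ x‖ < 1 := by
    rw [norm_neg]
    exact (norm_fderiv_le_of_lipschitz ℝ hγ).trans_lt (by exact_mod_cast hc)
  refine ⟨ContinuousLinearEquiv.unitsEquiv ℝ W (Units.oneSub _ hn), ?_⟩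
  have h := (hasFDerivAt_id x).add (hd x).hasFDerivAt
  have hA : ((ContinuousLinearEquiv.unitsEquiv ℝ W (Units.oneSub _ hn) : W ≃L[ℝ] W) : W →L[ℝ] W) =
      ContinuousLinearMap.id ℝ W + fderiv ℝ γ x := by
    ext y
    simp
  rw [hA]
  exact h

theorem LipschitzWith.contDiff_idAddHomeomorph_symm [CompleteSpace W] {γ : W → W} {c : ℝ≥0}
    (hγ : LipschitzWith c γ) (hc : c < 1) {m : WithTop ℕ∞} (hm : m ≠ 0) (hd : ContDiff ℝ m γ) :
    ContDiff ℝ m (hγ.idAddHomeomorph hc).symm := by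
  choose A hA using hγ.exists_hasFDerivAt_id_add hc (hd.differentiable hm)
  exact (hγ.idAddHomeomorph hc).contDiff_symm hA (contDiff_id.add hd)

end Perturbation

/-- Admissible fields have compact support in time, so the linear motion in `t` must be switched off
away from `t = 0`. -/
theorem exists_time_cutoff : ∃ θ : ℝ → ℝ, ContDiff ℝ ∞ θ ∧
    tsupport θ ⊆ Metric.closedBall 0 (1 / 2) ∧ ∀ t, |t| ≤ 1 / 4 → θ t = t := by
  let b : ContDiffBump (0 : ℝ) := ⟨1 / 4, 1 / 2, by norm_num, by norm_num⟩
  refine ⟨fun t => t * b t, contDiff_id.mul b.contDiff, ?_, fun t ht => ?_⟩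
  · exact (tsupport_mul_subset_right (f := fun t : ℝ => t) (g := b)).trans b.tsupport_eq.le
  · have : b t = 1 := b.one_of_mem_closedBall (by
      rw [Metric.mem_closedBall, Real.dist_eq, sub_zero]; exact ht)
    simp [this]

variable {n : ℕ}

/-- Stability along the explicit deformations `x ↦ x + t g(x) e`. -/
theorem IsStableSet.exists_forall_le {K : EuclideanSpace ℝ (Fin n) → ℝ}
    {Ω E : Set (EuclideanSpace ℝ (Fin n))} (hE : IsStableSet K Ω E)
    {g : EuclideanSpace ℝ (Fin n) → ℝ} (hg : ContDiff ℝ 2 g) (hgc : HasCompactSupport g)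
    (hgΩ : tsupport g ⊆ Ω) (e : EuclideanSpace ℝ (Fin n)) {ε : ℝ} (hε : 0 < ε) :
    ∃ t₀ : ℝ, 0 < t₀ ∧ ∀ t ∈ Ioo (-t₀) t₀,
      kernelPerimeter K Ω E ≤ kernelPerimeter K Ω (((fun x => x + (t * g x) • e) '' E) ∪ E)
        + ENNReal.ofReal (ε * t ^ 2) ∧
      kernelPerimeter K Ω E ≤ kernelPerimeter K Ω (((fun x => x + (t * g x) • e) '' E) ∩ E)
        + ENNReal.ofReal (ε * t ^ 2) := by
  obtain ⟨θ, hθ, hθs, hθt⟩ := exists_time_cutoff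
  have hθ2 : ContDiff ℝ 2 θ := contDiff_infty.1 hθ 2
  have hθ' : ContDiff ℝ 2 (deriv θ) :=
    contDiff_infty.1 (contDiff_infty_iff_deriv.1 hθ).2 2
  set S : Set (EuclideanSpace ℝ (Fin n) × ℝ) := tsupport g ×ˢ Metric.closedBall 0 (1 / 2) with hS
  have hSc : IsCompact S := hgc.isCompact.prod (isCompact_closedBall 0 (1 / 2))
  set γ₀ : EuclideanSpace ℝ (Fin n) × ℝ → EuclideanSpace ℝ (Fin n) × ℝ :=
    fun p => ((θ p.2 * g p.1) • e, 0) with hγ₀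
  have hγ₀2 : ContDiff ℝ 2 γ₀ := by
    refine ContDiff.prodMk (ContDiff.fun_smul (ContDiff.mul ?_ ?_) contDiff_const) contDiff_const
    · exact hθ2.comp contDiff_snd
    · exact hg.comp contDiff_fst
  have hγ₀z : ∀ p ∉ S, γ₀ p = 0 := by
    intro p hp
    have : θ p.2 * g p.1 = 0 := by
      by_contra hne
      refine hp ⟨subset_tsupport _ (right_ne_zero_of_mul hne), hθs ?_⟩
      exact subset_tsupport _ (left_ne_zero_of_mul hne)
    simp [hγ₀, this]
  have hγ₀c : HasCompactSupport γ₀ := HasCompactSupport.intro hSc hγ₀z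
  obtain ⟨M, hM⟩ := hγ₀2.lipschitzWith_of_hasCompactSupport hγ₀c (by norm_num)
  -- The factor slows the motion down until the space-time map is a perturbation of the identity
  -- with Lipschitz constant `1/2`, valid for all times at once.
  set c : ℝ≥0 := (2 * (M + 1))⁻¹ with hc
  have hc0 : 0 < c := by positivity
  have hγ : LipschitzWith (1 / 2 : ℝ≥0) (fun p => (c : ℝ) • γ₀ p) := by
    refine LipschitzWith.of_dist_le_mul fun p q => ?_
    rw [dist_smul₀, Real.norm_of_nonneg c.coe_nonneg]
    refine (mul_le_mul_of_nonneg_left (hM.dist_le_mul p q) c.coe_nonneg).trans ?_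
    rw [← mul_assoc]
    refine mul_le_mul_of_nonneg_right ?_ dist_nonneg
    rw [hc]
    push_cast
    rw [inv_mul_le_iff₀ (by positivity)]
    linarith
  have hhalf : (1 / 2 : ℝ≥0) < 1 := by
    rw [← NNReal.coe_lt_coe]; push_cast; norm_num
  set H := hγ.idAddHomeomorph hhalf with hH
  have hHs : ContDiff ℝ 2 H.symm :=
    hγ.contDiff_idAddHomeomorph_symm hhalf (by norm_num) (hγ₀2.const_smul (c : ℝ))
  have hH1 : ∀ x t, H (x, t) = (x + (c * θ t * g x) • e, t) := by
    intro x t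
    rw [hH, LipschitzWith.idAddHomeomorph_apply]
    simp only [hγ₀, Prod.smul_mk, Prod.mk_add_mk, smul_zero, add_zero, smul_smul, mul_assoc]
  have hH2 : ∀ p, (H p).2 = p.2 := fun p => by rw [← Prod.mk.eta (p := p), hH1]
  -- A point sent outside `S` would have a fixed point of `H` as its image, contradicting
  -- injectivity.
  have hHS : H '' S ⊆ S := by
    rintro _ ⟨p, hp, rfl⟩
    by_contra hn
    have h1 : H (H p) = H p := by
      rw [hH, LipschitzWith.idAddHomeomorph_apply, ← hH, hγ₀z _ hn, smul_zero, add_zero]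
    rw [H.injective h1] at hn
    exact hn hp
  -- The velocity of the prescribed motion, read at the current position through the inverse
  -- space-time map. The prescribed motion is then a flow of `X` by construction, and no existence
  -- theory for differential equations is needed.
  set X : EuclideanSpace ℝ (Fin n) × ℝ → EuclideanSpace ℝ (Fin n) :=
    fun p => (c * deriv θ (H.symm p).2 * g (H.symm p).1) • e with hX
  have hXz : ∀ p ∉ S, X p = 0 := by
    intro p hp
    have hq : H.symm p ∉ S := fun h => hp (by simpa using hHS (mem_image_of_mem H h))
    have : deriv θ (H.symm p).2 * g (H.symm p).1 = 0 := by
      by_contra hne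
      refine hq ⟨subset_tsupport _ (right_ne_zero_of_mul hne), hθs ?_⟩
      exact support_deriv_subset (left_ne_zero_of_mul hne)
    simp [hX, mul_assoc, this]
  have hXadm : IsAdmissibleField Ω X := by
    refine ⟨?_, HasCompactSupport.intro hSc hXz, ?_⟩
    · refine ContDiff.fun_smul (ContDiff.mul (contDiff_const.mul ?_) ?_) contDiff_const
      · exact hθ'.comp (contDiff_snd.comp hHs)
      · exact hg.comp (contDiff_fst.comp hHs)
    · refine (closure_minimal (fun p hp => ?_) hSc.isClosed).trans (prod_mono hgΩ ?_)
      · by_contra hn; exact hp (hXz p hn)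
      · intro t ht
        rw [Metric.mem_closedBall, Real.dist_eq, sub_zero, abs_le] at ht
        constructor <;> linarith [ht.1, ht.2]
  have hflow : IsIntegralFlow X (fun t x => x + (c * θ t * g x) • e) := by
    refine ⟨fun x => ?_, fun x t => ?_⟩
    · simp [hθt 0 (by norm_num)]
    · have h1 : HasDerivAt θ (deriv θ t) t :=
        (hθ2.differentiable (by norm_num) t).hasDerivAt
      have h2 : X (x + (c * θ t * g x) • e, t) = (c * deriv θ t * g x) • e := by
        rw [← hH1, hX]
        simp only [Homeomorph.symm_apply_apply]
      rw [h2]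
      exact (((h1.const_mul (c : ℝ)).mul_const (g x)).smul_const e).const_add x
  -- The flow at time `t / c` is the wanted deformation with parameter `t`; the factor `c ^ 2`
  -- compensates this change of time in the quadratic error.
  obtain ⟨t₀, ht₀, h⟩ := hE.stable X hXadm _ hflow (ε * c ^ 2) (by positivity)
  refine ⟨c * min t₀ (1 / 4), by positivity, fun t ht => ?_⟩
  have ht1 : |t / c| < min t₀ (1 / 4) := by
    rw [abs_div, abs_of_pos (show (0 : ℝ) < c from hc0), div_lt_iff₀ (by exact_mod_cast hc0),
      mul_comm, abs_lt]
    exact ht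
  have h3 := h (t / c) (abs_lt.1 (ht1.trans_le (min_le_left _ _)))
  have hcr : (c : ℝ) ≠ 0 := by exact_mod_cast hc0.ne'
  rw [hθt _ (ht1.le.trans (min_le_right _ _)), mul_div_cancel₀ _ hcr,
    show ε * (c : ℝ) ^ 2 * (t / c) ^ 2 = ε * t ^ 2 by field_simp] at h3
  exact h3

end Flow

/-! ### The perimeter as an integral over pairs -/

section Pairs

open scoped NNReal

variable {n : ℕ}

/-- The pairs `(x, y) ∈ E × Eᶜ` with `x ∈ Ω` or `y ∈ Ω`. -/
def pairSet {α : Type*} (Ω E : Set α) : Set (α × α) :=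
  {p | (p.1 ∈ E ∧ p.2 ∉ E) ∧ (p.1 ∈ Ω ∨ p.2 ∈ Ω)}

theorem measurableSet_pairSet {α : Type*} [MeasurableSpace α] {Ω E : Set α}
    (hΩ : MeasurableSet Ω) (hE : MeasurableSet E) : MeasurableSet (pairSet Ω E) :=
  ((measurable_fst hE).inter (measurable_snd hE.compl)).inter
    ((measurable_fst hΩ).union (measurable_snd hΩ))

theorem pairSet_mono {α : Type*} {Ω Ω' E : Set α} (h : Ω ⊆ Ω') : pairSet Ω E ⊆ pairSet Ω' E :=
  fun _ hp => ⟨hp.1, hp.2.imp (@h _) (@h _)⟩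

theorem kernelInteraction_eq_lintegral_prod {K : EuclideanSpace ℝ (Fin n) → ℝ} (hK : Measurable K)
    (A B : Set (EuclideanSpace ℝ (Fin n))) :
    kernelInteraction K A B =
      ∫⁻ p in A ×ˢ B, ENNReal.ofReal (K (p.1 - p.2)) ∂(volume.prod volume) := by
  rw [← Measure.prod_restrict, lintegral_prod]
  · rfl
  · exact (hK.comp (measurable_fst.sub measurable_snd)).ennreal_ofReal.aemeasurable

/-- The three interactions live on disjoint products that fill `pairSet Ω E`. As one integral over
pairs, inequalities between perimeters become pointwise inequalities. -/
theorem kernelPerimeter_eq_lintegral {K : EuclideanSpace ℝ (Fin n) → ℝ} (hK : Measurable K)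
    {Ω E : Set (EuclideanSpace ℝ (Fin n))} (hΩ : MeasurableSet Ω) (hE : MeasurableSet E) :
    kernelPerimeter K Ω E =
      ∫⁻ p in pairSet Ω E, ENNReal.ofReal (K (p.1 - p.2)) ∂(volume.prod volume) := by
  rw [kernelPerimeter, kernelInteraction_eq_lintegral_prod hK,
    kernelInteraction_eq_lintegral_prod hK, kernelInteraction_eq_lintegral_prod hK,
    ← lintegral_union, ← lintegral_union]
  · congr 2
    ext p
    simp only [pairSet, mem_union, mem_prod, mem_inter_iff, mem_sdiff, mem_compl_iff, mem_ofPred_eq]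
    tauto
  · exact (hE.diff hΩ).prod (hE.compl.inter hΩ)
  · rw [disjoint_left]
    rintro p hp hq
    simp only [mem_union, mem_prod, mem_inter_iff, mem_sdiff, mem_compl_iff] at hp hq
    tauto
  · exact (hE.inter hΩ).prod (hE.compl.diff hΩ)
  · rw [disjoint_left]
    rintro p hp hq
    simp only [mem_prod, mem_inter_iff, mem_sdiff, mem_compl_iff] at hp hq
    tauto

theorem kernelInteraction_congr_ae {K : EuclideanSpace ℝ (Fin n) → ℝ}
    {A A' B B' : Set (EuclideanSpace ℝ (Fin n))} (hA : A =ᵐ[volume] A') (hB : B =ᵐ[volume] B') :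
    kernelInteraction K A B = kernelInteraction K A' B' := by
  rw [kernelInteraction, kernelInteraction, Measure.restrict_congr_set hA,
    Measure.restrict_congr_set hB]

theorem kernelPerimeter_congr_ae {K : EuclideanSpace ℝ (Fin n) → ℝ}
    {Ω E E' : Set (EuclideanSpace ℝ (Fin n))} (h : E =ᵐ[volume] E') :
    kernelPerimeter K Ω E = kernelPerimeter K Ω E' := by
  have r : ∀ S : Set (EuclideanSpace ℝ (Fin n)), S =ᵐ[volume] S := fun S => Filter.EventuallyEq.rfl
  rw [kernelPerimeter, kernelPerimeter,
    kernelInteraction_congr_ae (h.inter (r Ω)) (h.compl.inter (r Ω)),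
    kernelInteraction_congr_ae (h.inter (r Ω)) (h.compl.diff (r Ω)),
    kernelInteraction_congr_ae (h.diff (r Ω)) (h.compl.inter (r Ω))]

/-- Submodularity of the perimeter, with part of the defect. -/
theorem kernelPerimeter_union_add_inter_le {K : EuclideanSpace ℝ (Fin n) → ℝ} (hK : Measurable K)
    {Ω B E F : Set (EuclideanSpace ℝ (Fin n))} (hΩ : MeasurableSet Ω) (hBΩ : B ⊆ Ω)
    (hB : MeasurableSet B) (hE : MeasurableSet E) (hF : MeasurableSet F) :
    kernelPerimeter K Ω (F ∪ E) + kernelPerimeter K Ω (F ∩ E)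
        + kernelInteraction K (B ∩ (F \ E)) (B ∩ (E \ F)) ≤
      kernelPerimeter K Ω F + kernelPerimeter K Ω E := by
  have hk : Measurable fun p : EuclideanSpace ℝ (Fin n) × EuclideanSpace ℝ (Fin n) =>
      ENNReal.ofReal (K (p.1 - p.2)) :=
    (hK.comp (measurable_fst.sub measurable_snd)).ennreal_ofReal
  have m1 := measurableSet_pairSet hΩ (hF.union hE)
  have m2 := measurableSet_pairSet hΩ (hF.inter hE)
  have m3 := measurableSet_pairSet hΩ hF
  have m4 := measurableSet_pairSet hΩ hE
  have m5 := (hB.inter (hF.diff hE)).prod (hB.inter (hE.diff hF))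
  rw [kernelPerimeter_eq_lintegral hK hΩ (hF.union hE),
    kernelPerimeter_eq_lintegral hK hΩ (hF.inter hE), kernelPerimeter_eq_lintegral hK hΩ hF,
    kernelPerimeter_eq_lintegral hK hΩ hE, kernelInteraction_eq_lintegral_prod hK,
    ← lintegral_indicator m1, ← lintegral_indicator m2, ← lintegral_indicator m3,
    ← lintegral_indicator m4, ← lintegral_indicator m5,
    ← lintegral_add_left (hk.indicator m1), ← lintegral_add_right _ (hk.indicator m5),
    ← lintegral_add_left (hk.indicator m3)]
  refine lintegral_mono fun p => ?_
  have h1 := @hBΩ p.1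
  have h2 := @hBΩ p.2
  simp only [pairSet]
  -- Pointwise the claim is combinatorial: a pair in `(F \ E) × (E \ F)` counts for `F` alone, and
  -- for neither the union nor the intersection; this leaves room for the defect.
  by_cases a1 : p.1 ∈ E <;> by_cases a2 : p.2 ∈ E <;> by_cases b1 : p.1 ∈ F <;>
    by_cases b2 : p.2 ∈ F <;> simp [a1, a2, b1, b2]
  all_goals
    by_cases c1 : p.1 ∈ B <;> by_cases c2 : p.2 ∈ B <;> by_cases d1 : p.1 ∈ Ω <;>
      by_cases d2 : p.2 ∈ Ω <;> simp_all

end Pairs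

/-! ### Change of variables -/

section Deformation

open scoped NNReal

variable {n : ℕ} {G : EuclideanSpace ℝ (Fin n) → ℝ} {e : EuclideanSpace ℝ (Fin n)} {q : ℝ≥0}

theorem LipschitzWith.smul_unit {E : Type*} [NormedAddCommGroup E] [NormedSpace ℝ E] {G : E → ℝ}
    {e : E} {q : ℝ≥0} (hG : LipschitzWith q G) (he : ‖e‖ = 1) :
    LipschitzWith q (fun x => G x • e) := by
  refine LipschitzWith.of_dist_le_mul fun x y => ?_
  rw [dist_eq_norm, ← sub_smul, norm_smul, he, mul_one, ← dist_eq_norm]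
  exact hG.dist_le_mul x y

theorem abs_fderiv_apply_le (hG : LipschitzWith q G) (he : ‖e‖ = 1)
    (x : EuclideanSpace ℝ (Fin n)) : |fderiv ℝ G x e| ≤ q := by
  have := (fderiv ℝ G x).le_of_opNorm_le (norm_fderiv_le_of_lipschitz ℝ hG) e
  rwa [he, mul_one] at this

theorem lintegral_comp_deformation (hG : LipschitzWith q G) (hq : q < 1) (he : ‖e‖ = 1)
    (hd : Differentiable ℝ G) (F : EuclideanSpace ℝ (Fin n) → ENNReal) :
    ∫⁻ x, F x = ∫⁻ x, ENNReal.ofReal (1 + fderiv ℝ G x e) * F (x + G x • e) := by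
  have hder : ∀ x ∈ (univ : Set (EuclideanSpace ℝ (Fin n))),
      HasFDerivWithinAt (fun x => x + G x • e)
        (ContinuousLinearMap.id ℝ _ + (fderiv ℝ G x).smulRight e) univ x := fun x _ =>
    ((hasFDerivAt_id x).add ((hd x).hasFDerivAt.smul_const e)).hasFDerivWithinAt
  have hinj : InjOn (fun x => x + G x • e) univ :=
    ((hG.smul_unit he).idAddHomeomorph hq).injective.injOn
  have hsurj : (fun x => x + G x • e) '' univ = univ := by
    rw [image_univ]
    exact ((hG.smul_unit he).idAddHomeomorph hq).surjective.range_eq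
  have h := lintegral_image_eq_lintegral_abs_det_fderiv_mul volume MeasurableSet.univ hder hinj F
  rw [hsurj, setLIntegral_univ, setLIntegral_univ] at h
  rw [h]
  refine lintegral_congr fun x => ?_
  -- Moving in a fixed direction makes the derivative a rank-one perturbation of the identity, so
  -- the Jacobian is exactly linear in `G`.
  have hdet : (ContinuousLinearMap.id ℝ _ + (fderiv ℝ G x).smulRight e).det
      = 1 + fderiv ℝ G x e := by
    refine Eq.trans ?_ (LinearMap.transvection.det (fderiv ℝ G x).toLinearMap e)
    rfl
  have h1 := abs_le.1 (abs_fderiv_apply_le hG he x)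
  have h2 : (q : ℝ) < 1 := by exact_mod_cast hq
  rw [hdet, abs_of_nonneg (by linarith)]

theorem lintegral_prod_comp_deformation (hG : LipschitzWith q G) (hq : q < 1) (he : ‖e‖ = 1)
    (hd : ContDiff ℝ 1 G) {F : EuclideanSpace ℝ (Fin n) × EuclideanSpace ℝ (Fin n) → ENNReal}
    (hF : Measurable F) :
    ∫⁻ p, F p ∂(volume.prod volume) =
      ∫⁻ p, ENNReal.ofReal ((1 + fderiv ℝ G p.1 e) * (1 + fderiv ℝ G p.2 e)) *
        F (p.1 + G p.1 • e, p.2 + G p.2 • e) ∂(volume.prod volume) := by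
  have hJ : Continuous fun x => 1 + fderiv ℝ G x e :=
    continuous_const.add ((hd.continuous_fderiv (by norm_num)).clm_apply continuous_const)
  have hΦ : Continuous fun x => x + G x • e := continuous_id.add (hd.continuous.smul continuous_const)
  have hJ0 : ∀ x, 0 ≤ 1 + fderiv ℝ G x e := fun x => by
    have h1 := abs_le.1 (abs_fderiv_apply_le hG he x)
    have h2 : (q : ℝ) < 1 := by exact_mod_cast hq
    linarith
  have hdif := hd.differentiable (by norm_num)
  rw [lintegral_prod _ hF.aemeasurable, lintegral_prod]
  · rw [lintegral_comp_deformation hG hq he hdif]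
    refine lintegral_congr fun x => ?_
    rw [lintegral_comp_deformation hG hq he hdif, ← lintegral_const_mul' _ _ ENNReal.ofReal_ne_top]
    refine lintegral_congr fun y => ?_
    rw [ENNReal.ofReal_mul (hJ0 x), mul_assoc]
  · refine (Measurable.mul ?_ (hF.comp ?_)).aemeasurable
    · exact ((hJ.comp continuous_fst).mul (hJ.comp continuous_snd)).measurable.ennreal_ofReal
    · exact ((hΦ.comp continuous_fst).prodMk (hΦ.comp continuous_snd)).measurable

variable {K : EuclideanSpace ℝ (Fin n) → ℝ} {Ω B E : Set (EuclideanSpace ℝ (Fin n))}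

theorem measurableSet_image_deformation (hG : LipschitzWith q G) (hq : q < 1) (he : ‖e‖ = 1)
    (hE : MeasurableSet E) : MeasurableSet ((fun x => x + G x • e) '' E) :=
  ((hG.smul_unit he).idAddHomeomorph hq).measurableEmbedding.measurableSet_image.2 hE

/-- The map fixes every point outside `B`, so by injectivity it cannot carry a point of `B` out of
`B`. -/
theorem deformation_mem_iff (hG : LipschitzWith q G) (hq : q < 1) (he : ‖e‖ = 1)
    (hBΩ : B ⊆ Ω) (hGB : ∀ x ∉ B, G x = 0) (x : EuclideanSpace ℝ (Fin n)) :
    x + G x • e ∈ Ω ↔ x ∈ Ω := by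
  by_cases hx : x ∈ B
  · refine iff_of_true (hBΩ ?_) (hBΩ hx)
    by_contra hn
    have h1 : (fun x => x + G x • e) (x + G x • e) = (fun x => x + G x • e) x := by
      simp only [hGB _ hn, zero_smul, add_zero]
    rw [((hG.smul_unit he).idAddHomeomorph hq).injective h1] at hn
    exact hn hx
  · rw [hGB x hx, zero_smul, add_zero]

theorem kernelPerimeter_image_deformation (hK : Measurable K) (hG : LipschitzWith q G) (hq : q < 1)
    (he : ‖e‖ = 1) (hd : ContDiff ℝ 1 G) (hBΩ : B ⊆ Ω) (hGB : ∀ x ∉ B, G x = 0)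
    (hΩ : MeasurableSet Ω) (hE : MeasurableSet E) :
    kernelPerimeter K Ω ((fun x => x + G x • e) '' E) =
      ∫⁻ p in pairSet Ω E, ENNReal.ofReal ((1 + fderiv ℝ G p.1 e) * (1 + fderiv ℝ G p.2 e)) *
        ENNReal.ofReal (K (p.1 + G p.1 • e - (p.2 + G p.2 • e))) ∂(volume.prod volume) := by
  have hF := measurableSet_image_deformation hG hq he hE
  have hinj : Function.Injective (fun x => x + G x • e) :=
    ((hG.smul_unit he).idAddHomeomorph hq).injective
  have hk : Measurable fun p : EuclideanSpace ℝ (Fin n) × EuclideanSpace ℝ (Fin n) =>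
      ENNReal.ofReal (K (p.1 - p.2)) :=
    (hK.comp (measurable_fst.sub measurable_snd)).ennreal_ofReal
  have m1 := measurableSet_pairSet hΩ hF
  have m2 := measurableSet_pairSet hΩ hE
  rw [kernelPerimeter_eq_lintegral hK hΩ hF, ← lintegral_indicator m1, ← lintegral_indicator m2,
    lintegral_prod_comp_deformation hG hq he hd (hk.indicator m1)]
  refine lintegral_congr fun p => ?_
  have hmem : (p.1 + G p.1 • e, p.2 + G p.2 • e) ∈ pairSet Ω ((fun x => x + G x • e) '' E) ↔
      p ∈ pairSet Ω E := by
    simp only [pairSet, mem_ofPred_eq, deformation_mem_iff hG hq he hBΩ hGB]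
    have : ∀ x, x + G x • e ∈ (fun x => x + G x • e) '' E ↔ x ∈ E := fun x =>
      hinj.mem_set_image (a := x)
    rw [this, this]
  by_cases hp : p ∈ pairSet Ω E
  · rw [indicator_of_mem hp, indicator_of_mem (hmem.2 hp)]
  · rw [indicator_of_notMem hp, indicator_of_notMem (fun h => hp (hmem.1 h)), mul_zero]

/-- Second variation of the perimeter along a deformation and its opposite. -/
theorem kernelPerimeter_deformation_add_le {s lam Lam : ℝ} (hK : IsKernelL2 s lam Lam K)
    (hs : 0 < s) (hl : 0 < lam) (hL : 0 < Lam) (hG : LipschitzWith q G) (hq : q ≤ 1 / 2)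
    (he : ‖e‖ = 1) (hd : ContDiff ℝ 1 G) (hBΩ : B ⊆ Ω) (hGB : ∀ x ∉ B, G x = 0)
    (hB : IsOpen B) (hcl : ∀ x ∉ B, fderiv ℝ G x = 0)
    (hΩ : MeasurableSet Ω) (hE : MeasurableSet E) :
    kernelPerimeter K Ω ((fun x => x + G x • e) '' E) +
        kernelPerimeter K Ω ((fun x => x + (-G x) • e) '' E) ≤
      2 * kernelPerimeter K Ω E +
        ENNReal.ofReal (18 * (2 ^ ((n : ℝ) + s) * Lam / lam) * q ^ 2) * kernelPerimeter K B E := by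
  have hKm := hK.measurable hs hl
  have hq1 : q < 1 := hq.trans_lt (by rw [← NNReal.coe_lt_coe]; push_cast; norm_num)
  have hqr : (q : ℝ) ≤ 1 / 2 := by exact_mod_cast hq
  have hk : Measurable fun p : EuclideanSpace ℝ (Fin n) × EuclideanSpace ℝ (Fin n) =>
      ENNReal.ofReal (K (p.1 - p.2)) :=
    (hKm.comp (measurable_fst.sub measurable_snd)).ennreal_ofReal
  set C := 18 * (2 ^ ((n : ℝ) + s) * Lam / lam) * (q : ℝ) ^ 2 with hC
  have hC0 : 0 ≤ C := by positivity
  have m1 := measurableSet_pairSet hΩ hE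
  have m2 := measurableSet_pairSet hB.measurableSet hE
  rw [kernelPerimeter_image_deformation hKm hG hq1 he hd hBΩ hGB hΩ hE,
    kernelPerimeter_image_deformation (G := fun x => -G x) hKm hG.neg hq1 he hd.neg hBΩ
      (fun x hx => by rw [hGB x hx, neg_zero]) hΩ hE,
    kernelPerimeter_eq_lintegral hKm hΩ hE, kernelPerimeter_eq_lintegral hKm hB.measurableSet hE,
    ← lintegral_indicator m1, ← lintegral_indicator m1, ← lintegral_indicator m1,
    ← lintegral_indicator m2, ← lintegral_const_mul _ (hk.indicator m1),
    ← lintegral_const_mul _ (hk.indicator m2),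
    ← lintegral_add_left ((hk.indicator m1).const_mul _), ← lintegral_add_left]
  · refine lintegral_mono fun p => ?_
    by_cases hp : p ∈ pairSet Ω E
    swap
    · have hp' : p ∉ pairSet B E := fun h => hp (pairSet_mono hBΩ h)
      simp [indicator_of_notMem hp]
    have hne : p.1 - p.2 ≠ 0 := by
      rw [sub_ne_zero]
      intro h
      exact hp.1.2 (h ▸ hp.1.1)
    have hk0 := hK.nonneg hl hne
    by_cases hp' : p ∈ pairSet B E
    · simp only [indicator_of_mem hp, indicator_of_mem hp']
      have hω : ‖(G p.1 - G p.2) • e‖ ≤ q * ‖p.1 - p.2‖ := by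
        rw [norm_smul, he, mul_one, ← dist_eq_norm, ← dist_eq_norm]
        exact hG.dist_le_mul _ _
      have ha := abs_fderiv_apply_le hG he p.1
      have hb := abs_fderiv_apply_le hG he p.2
      have h := hK.second_variation hs hl hne hqr hω ha hb
      have r1 : p.1 + G p.1 • e - (p.2 + G p.2 • e) = p.1 - p.2 + (G p.1 - G p.2) • e := by
        module
      have r2 : p.1 + (-G p.1) • e - (p.2 + (-G p.2) • e) = p.1 - p.2 - (G p.1 - G p.2) • e := by
        module
      have r3 : ∀ x, fderiv ℝ (fun x => -G x) x e = -fderiv ℝ G x e := fun x => by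
        rw [fderiv_fun_neg]; rfl
      have pos : ∀ x, 0 ≤ 1 + fderiv ℝ G x e ∧ 0 ≤ 1 - fderiv ℝ G x e := fun x => by
        have := abs_le.1 (abs_fderiv_apply_le hG he x)
        constructor <;> linarith
      have e2 : 2 * ENNReal.ofReal (K (p.1 - p.2)) = ENNReal.ofReal (2 * K (p.1 - p.2)) := by
        rw [ENNReal.ofReal_mul zero_le_two, ENNReal.ofReal_ofNat]
      rw [r1, r2, r3, r3, ← sub_eq_add_neg, ← sub_eq_add_neg,
        ← ENNReal.ofReal_mul (mul_nonneg (pos _).1 (pos _).1),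
        ← ENNReal.ofReal_mul (mul_nonneg (pos _).2 (pos _).2),
        ← ENNReal.ofReal_mul hC0, e2]
      have kp : 0 ≤ K (p.1 - p.2 + (G p.1 - G p.2) • e) := by
        refine hK.nonneg hl (norm_pos_iff.1 (lt_of_lt_of_le (half_pos (norm_pos_iff.2 hne)) ?_))
        simpa using le_norm_add_smul hqr hω (τ := 1) (by norm_num)
      have km : 0 ≤ K (p.1 - p.2 - (G p.1 - G p.2) • e) := by
        refine hK.nonneg hl (norm_pos_iff.1 (lt_of_lt_of_le (half_pos (norm_pos_iff.2 hne)) ?_))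
        have := le_norm_add_smul hqr hω (τ := -1) (by norm_num)
        rwa [neg_one_smul, ← sub_eq_add_neg] at this
      rw [← ENNReal.ofReal_add (mul_nonneg (mul_nonneg (pos _).1 (pos _).1) kp)
        (mul_nonneg (mul_nonneg (pos _).2 (pos _).2) km),
        ← ENNReal.ofReal_add (by positivity) (by positivity)]
      refine ENNReal.ofReal_le_ofReal ?_
      rw [hC]
      linarith
    -- A pair with both points outside `B` is not moved and contributes exactly twice its kernel
    -- value; this confines the error to `kernelPerimeter K B E`.
    · have hx : p.1 ∉ B := fun h => hp' ⟨hp.1, Or.inl h⟩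
      have hy : p.2 ∉ B := fun h => hp' ⟨hp.1, Or.inr h⟩
      have r3 : ∀ x ∉ B, fderiv ℝ (fun x => -G x) x = 0 := fun x hx => by
        rw [fderiv_fun_neg, hcl x hx, neg_zero]
      simp only [indicator_of_mem hp, indicator_of_notMem hp', hGB _ hx, hGB _ hy, hcl _ hx,
        hcl _ hy, r3 _ hx, r3 _ hy]
      simp [two_mul]
  · refine Measurable.indicator (Measurable.mul ?_ (Measurable.ennreal_ofReal (hKm.comp ?_))) m1
    · have hJ : Continuous fun x => 1 + fderiv ℝ G x e :=
        continuous_const.add ((hd.continuous_fderiv (by norm_num)).clm_apply continuous_const)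
      exact ((hJ.comp continuous_fst).mul (hJ.comp continuous_snd)).measurable.ennreal_ofReal
    · have hΦ : Continuous fun x => x + G x • e :=
        continuous_id.add (hd.continuous.smul continuous_const)
      exact ((hΦ.comp continuous_fst).sub (hΦ.comp continuous_snd)).measurable

/-- Sets that almost minimise along a deformation and its opposite: the interaction between
the gained and the lost parts is controlled by the second variation. -/
theorem kernelInteraction_deformation_le {s lam Lam : ℝ} (hK : IsKernelL2 s lam Lam K)
    (hs : 0 < s) (hl : 0 < lam) (hL : 0 < Lam) (hG : LipschitzWith q G) (hq : q ≤ 1 / 2)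
    (he : ‖e‖ = 1) (hd : ContDiff ℝ 1 G) (hBΩ : B ⊆ Ω) (hGB : ∀ x ∉ B, G x = 0)
    (hB : IsOpen B) (hcl : ∀ x ∉ B, fderiv ℝ G x = 0)
    (hΩ : MeasurableSet Ω) (hE : MeasurableSet E) (hfin : kernelPerimeter K Ω E < ⊤)
    {δ : ENNReal}
    (h1 : kernelPerimeter K Ω E ≤ kernelPerimeter K Ω (((fun x => x + G x • e) '' E) ∪ E) + δ)
    (h2 : kernelPerimeter K Ω E ≤ kernelPerimeter K Ω (((fun x => x + G x • e) '' E) ∩ E) + δ)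
    (h3 : kernelPerimeter K Ω E ≤ kernelPerimeter K Ω (((fun x => x + (-G x) • e) '' E) ∪ E) + δ)
    (h4 : kernelPerimeter K Ω E ≤
      kernelPerimeter K Ω (((fun x => x + (-G x) • e) '' E) ∩ E) + δ) :
    kernelInteraction K (B ∩ (((fun x => x + G x • e) '' E) \ E))
        (B ∩ (E \ ((fun x => x + G x • e) '' E))) ≤
      ENNReal.ofReal (18 * (2 ^ ((n : ℝ) + s) * Lam / lam) * q ^ 2) * kernelPerimeter K B E
        + 4 * δ := by
  have hKm := hK.measurable hs hl
  have hq1 : q < 1 := hq.trans_lt (by rw [← NNReal.coe_lt_coe]; push_cast; norm_num)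
  have key := kernelPerimeter_deformation_add_le hK hs hl hL hG hq he hd hBΩ hGB hB hcl hΩ hE
  have s1 := kernelPerimeter_union_add_inter_le hKm hΩ hBΩ hB.measurableSet hE
    (measurableSet_image_deformation hG hq1 he hE)
  have s2 := kernelPerimeter_union_add_inter_le hKm hΩ hBΩ hB.measurableSet hE
    (measurableSet_image_deformation (G := fun x => -G x) hG.neg hq1 he hE)
  set P := kernelPerimeter K Ω E
  set m := kernelInteraction K (B ∩ (((fun x => x + G x • e) '' E) \ E))
        (B ∩ (E \ ((fun x => x + G x • e) '' E)))
  -- The defect is kept for one deformation and dropped for the opposite one, which serves only to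
  -- cancel the first variation. Finiteness of `P` allows cancellation in `[0, ∞]`.
  have a1 : P + (P + m) ≤ P + (kernelPerimeter K Ω ((fun x => x + G x • e) '' E) + 2 * δ) := by
    calc P + (P + m) ≤ _ + (_ + m) := add_le_add h1 (add_le_add h2 le_rfl)
      _ = kernelPerimeter K Ω (((fun x => x + G x • e) '' E) ∪ E) +
          kernelPerimeter K Ω (((fun x => x + G x • e) '' E) ∩ E) + m + 2 * δ := by ring
      _ ≤ _ := add_le_add s1 le_rfl
      _ = _ := by ring
  have a2 : P + P ≤ P + (kernelPerimeter K Ω ((fun x => x + (-G x) • e) '' E) + 2 * δ) := by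
    calc P + P ≤ _ + _ := add_le_add h3 h4
      _ = kernelPerimeter K Ω (((fun x => x + (-G x) • e) '' E) ∪ E) +
          kernelPerimeter K Ω (((fun x => x + (-G x) • e) '' E) ∩ E) + 2 * δ := by ring
      _ ≤ _ := add_le_add (le_self_add.trans s2) le_rfl
      _ = _ := by ring
  have b1 := (ENNReal.add_le_add_iff_left hfin.ne).1 a1
  have b2 := (ENNReal.add_le_add_iff_left hfin.ne).1 a2
  have hfin2 : 2 * P ≠ ⊤ := ENNReal.mul_ne_top (by norm_num) hfin.ne
  refine (ENNReal.add_le_add_iff_left hfin2).1 ?_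
  calc 2 * P + m = (P + m) + P := by ring
    _ ≤ _ := add_le_add b1 b2
    _ = _ + 4 * δ := by ring
    _ ≤ _ := add_le_add key le_rfl
    _ = _ := by ring

end Deformation

/-! ### Shear stability and translations -/

section Shift

open scoped NNReal

variable {n : ℕ}

/-- Stability of `E` along the deformations `x ↦ x + t g(x) e`. -/
def IsShearStable (K : EuclideanSpace ℝ (Fin n) → ℝ) (Ω E : Set (EuclideanSpace ℝ (Fin n))) :
    Prop :=
  ∀ g : EuclideanSpace ℝ (Fin n) → ℝ, ContDiff ℝ 2 g → HasCompactSupport g → tsupport g ⊆ Ω →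
    ∀ e : EuclideanSpace ℝ (Fin n), ∀ ε : ℝ, 0 < ε → ∃ t₀ : ℝ, 0 < t₀ ∧ ∀ t ∈ Ioo (-t₀) t₀,
      kernelPerimeter K Ω E ≤ kernelPerimeter K Ω (((fun x => x + (t * g x) • e) '' E) ∪ E)
        + ENNReal.ofReal (ε * t ^ 2) ∧
      kernelPerimeter K Ω E ≤ kernelPerimeter K Ω (((fun x => x + (t * g x) • e) '' E) ∩ E)
        + ENNReal.ofReal (ε * t ^ 2)

/-- Differentiable maps send null sets to null sets. This lets a null-measurable stable set be
replaced by a measurable representative. -/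
theorem ae_eq_image_of_differentiable {Φ : EuclideanSpace ℝ (Fin n) → EuclideanSpace ℝ (Fin n)}
    (hΦ : Differentiable ℝ Φ) {E E' : Set (EuclideanSpace ℝ (Fin n))} (h : E =ᵐ[volume] E') :
    (Φ '' E : Set _) =ᵐ[volume] (Φ '' E' : Set _) := by
  rw [← measure_symmDiff_eq_zero_iff] at h ⊢
  refine measure_mono_null (t := Φ '' (symmDiff E E')) ?_
    (addHaar_image_eq_zero_of_differentiableOn_of_addHaar_eq_zero volume hΦ.differentiableOn h)
  rintro y (⟨⟨x, hx, rfl⟩, hy⟩ | ⟨⟨x, hx, rfl⟩, hy⟩)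
  · exact ⟨x, Or.inl ⟨hx, fun h => hy ⟨x, h, rfl⟩⟩, rfl⟩
  · exact ⟨x, Or.inr ⟨hx, fun h => hy ⟨x, h, rfl⟩⟩, rfl⟩

theorem IsStableSet.isShearStable_of_ae_eq {K : EuclideanSpace ℝ (Fin n) → ℝ}
    {Ω E E' : Set (EuclideanSpace ℝ (Fin n))} (hE : IsStableSet K Ω E) (h : E =ᵐ[volume] E') :
    IsShearStable K Ω E' := by
  intro g hg hgc hgΩ e ε hε
  obtain ⟨t₀, ht₀, H⟩ := hE.exists_forall_le hg hgc hgΩ e hε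
  refine ⟨t₀, ht₀, fun t ht => ?_⟩
  have hd : Differentiable ℝ fun x => x + (t * g x) • e :=
    differentiable_id.add (((hg.differentiable (by norm_num)).const_mul t).smul_const e)
  have h1 := ae_eq_image_of_differentiable hd h
  rw [← kernelPerimeter_congr_ae h, ← kernelPerimeter_congr_ae (h1.union h),
    ← kernelPerimeter_congr_ae (h1.inter h)]
  exact H t ht

/-- One profile is rescaled, so `L` does not depend on the ball. The plateau reaches beyond radius
`ρ`, leaving room for preimages under translations shorter than `ρ / 4`. -/
theorem exists_scaled_bump (n : ℕ) : ∃ L : ℝ≥0, ∀ (x₀ : EuclideanSpace ℝ (Fin n)) (ρ : ℝ≥0),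
    0 < ρ → ∃ g : EuclideanSpace ℝ (Fin n) → ℝ, ContDiff ℝ 2 g ∧ HasCompactSupport g ∧
      tsupport g ⊆ Metric.ball x₀ (3 / 2 * ρ) ∧ (∀ x ∈ Metric.closedBall x₀ (5 / 4 * ρ), g x = 1) ∧
      LipschitzWith (L / ρ) g := by
  let ψ : ContDiffBump (0 : EuclideanSpace ℝ (Fin n)) := ⟨5 / 4, 11 / 8, by norm_num, by norm_num⟩
  obtain ⟨L, hL⟩ := (ψ.contDiff (n := 1)).lipschitzWith_of_hasCompactSupport ψ.hasCompactSupport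
    (by norm_num)
  refine ⟨L, fun x₀ ρ hρ => ?_⟩
  have hρ' : (0 : ℝ) < ρ := hρ
  have hz : ∀ x ∉ Metric.closedBall x₀ (11 / 8 * ρ), ψ ((ρ : ℝ)⁻¹ • (x - x₀)) = 0 := by
    intro x hx
    refine ψ.zero_of_le_dist ?_
    rw [Metric.mem_closedBall, not_le] at hx
    rw [dist_zero_right, norm_smul, norm_inv, Real.norm_of_nonneg hρ'.le, ← dist_eq_norm,
      le_inv_mul_iff₀ hρ', mul_comm]
    exact hx.le
  have hcpt := isCompact_closedBall x₀ (11 / 8 * (ρ : ℝ))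
  refine ⟨fun x => ψ ((ρ : ℝ)⁻¹ • (x - x₀)), ?_, HasCompactSupport.intro hcpt hz, ?_, ?_, ?_⟩
  · exact ψ.contDiff.comp ((contDiff_id.sub contDiff_const).const_smul _)
  · refine (closure_minimal (fun x hx => ?_) hcpt.isClosed).trans
      (Metric.closedBall_subset_ball (by linarith))
    by_contra hn
    exact hx (hz x hn)
  · intro x hx
    refine ψ.one_of_mem_closedBall ?_
    rw [Metric.mem_closedBall] at hx ⊢
    rw [dist_zero_right, norm_smul, norm_inv, Real.norm_of_nonneg hρ'.le, ← dist_eq_norm,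
      inv_mul_le_iff₀ hρ', mul_comm]
    exact hx
  · refine LipschitzWith.of_dist_le_mul fun x y => ?_
    refine (hL.dist_le_mul _ _).trans (le_of_eq ?_)
    rw [dist_smul₀, norm_inv, Real.norm_of_nonneg hρ'.le, dist_sub_right]
    push_cast
    ring

theorem kernelPerimeter_mono {K : EuclideanSpace ℝ (Fin n) → ℝ} (hK : Measurable K)
    {B Ω E : Set (EuclideanSpace ℝ (Fin n))} (hB : MeasurableSet B) (hΩ : MeasurableSet Ω)
    (hE : MeasurableSet E) (h : B ⊆ Ω) : kernelPerimeter K B E ≤ kernelPerimeter K Ω E := by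
  rw [kernelPerimeter_eq_lintegral hK hB hE, kernelPerimeter_eq_lintegral hK hΩ hE]
  exact lintegral_mono_set (pairSet_mono h)

theorem le_kernelInteraction_of_subset_ball {s lam Lam : ℝ} {K : EuclideanSpace ℝ (Fin n) → ℝ}
    (hK : IsKernelL2 s lam Lam K) (hs : 0 < s) (hl : 0 < lam) {x₀ : EuclideanSpace ℝ (Fin n)}
    {ρ : ℝ} {A D : Set (EuclideanSpace ℝ (Fin n))} (hA : A ⊆ Metric.ball x₀ ρ)
    (hD : D ⊆ Metric.ball x₀ ρ) (hAm : MeasurableSet A) (hDm : MeasurableSet D)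
    (hAD : Disjoint A D) :
    ENNReal.ofReal (lam / (2 * ρ) ^ ((n : ℝ) + s)) * (volume A * volume D) ≤
      kernelInteraction K A D := by
  have key : ∀ x ∈ A, ∀ y ∈ D, ENNReal.ofReal (lam / (2 * ρ) ^ ((n : ℝ) + s)) ≤
      ENNReal.ofReal (K (x - y)) := by
    intro x hx y hy
    have hne : x - y ≠ 0 := sub_ne_zero.2 fun h => disjoint_left.1 hAD hx (h ▸ hy)
    refine ENNReal.ofReal_le_ofReal (le_trans ?_ (hK.lower _ hne))
    have h1 : ‖x - y‖ ≤ 2 * ρ := by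
      have a1 := Metric.mem_ball.1 (hA hx)
      have a2 := Metric.mem_ball.1 (hD hy)
      rw [← dist_eq_norm]
      linarith [dist_triangle_right x y x₀]
    have h2 : 0 < ‖x - y‖ := norm_pos_iff.2 hne
    gcongr
  calc ENNReal.ofReal (lam / (2 * ρ) ^ ((n : ℝ) + s)) * (volume A * volume D)
      = ∫⁻ _ in A, ∫⁻ _ in D, ENNReal.ofReal (lam / (2 * ρ) ^ ((n : ℝ) + s)) := by
        rw [setLIntegral_const, setLIntegral_const]; ring
    _ ≤ _ := setLIntegral_mono' hAm fun x hx => setLIntegral_mono' hDm fun y hy => key x hx y hy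

/-- The points of `B` at which the indicator functions of `E` and of `E + z` differ. -/
def shiftDiff (E B : Set (EuclideanSpace ℝ (Fin n))) (z : EuclideanSpace ℝ (Fin n)) :
    Set (EuclideanSpace ℝ (Fin n)) :=
  B ∩ symmDiff ((fun x => x - z) ⁻¹' E) E

theorem volume_ball_eq_ofReal (c : EuclideanSpace ℝ (Fin n)) {r : ℝ} (hr : 0 < r) :
    volume (Metric.ball c r) =
      ENNReal.ofReal (r ^ n * volume.real (Metric.ball (0 : EuclideanSpace ℝ (Fin n)) 1)) := by
  rw [Measure.addHaar_ball_of_pos _ _ hr, finrank_euclideanSpace, Fintype.card_fin,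
    ENNReal.ofReal_mul (by positivity), measureReal_def, ENNReal.ofReal_toReal
      measure_ball_lt_top.ne]

theorem volume_ball_diff_ball_le {c c' : EuclideanSpace ℝ (Fin n)} {ρ t : ℝ} (hρ : 0 < ρ)
    (h : dist c c' ≤ t) (ht : t ≤ ρ) :
    volume (Metric.ball c ρ \ Metric.ball c' ρ) ≤
      ENNReal.ofReal (t * (n * (2 * ρ) ^ (n - 1) * volume.real (Metric.ball (0 : EuclideanSpace ℝ (Fin n)) 1))) := by
  have ht0 : 0 ≤ t := dist_nonneg.trans h
  have hsub : Metric.ball c ρ ⊆ Metric.ball c' (ρ + t) := Metric.ball_subset_ball' (by linarith)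
  have hsub' : Metric.ball c' ρ ⊆ Metric.ball c' (ρ + t) := Metric.ball_subset_ball (by linarith)
  have hpow : (ρ + t) ^ n - ρ ^ n ≤ t * (n * (2 * ρ) ^ (n - 1)) := by
    have h1 : ∀ x ∈ Icc ρ (ρ + t), HasDerivWithinAt (fun y : ℝ => y ^ n) (n * x ^ (n - 1))
        (Icc ρ (ρ + t)) x := fun x _ => (hasDerivAt_pow n x).hasDerivWithinAt
    have h2 : ∀ x ∈ Icc ρ (ρ + t), ‖(n : ℝ) * x ^ (n - 1)‖ ≤ n * (2 * ρ) ^ (n - 1) := by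
      intro x hx
      have : 0 ≤ x := hρ.le.trans hx.1
      rw [Real.norm_of_nonneg (by positivity)]
      gcongr
      linarith [hx.2]
    have h3 := (convex_Icc ρ (ρ + t)).norm_image_sub_le_of_norm_hasDerivWithin_le h1 h2
      (left_mem_Icc.2 (by linarith)) (right_mem_Icc.2 (by linarith))
    rw [add_sub_cancel_left, Real.norm_of_nonneg ht0] at h3
    linarith [(le_abs_self _).trans h3]
  calc volume (Metric.ball c ρ \ Metric.ball c' ρ)
      ≤ volume (Metric.ball c' (ρ + t) \ Metric.ball c' ρ) :=
        measure_mono (sdiff_subset_sdiff_left hsub)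
    _ = volume (Metric.ball c' (ρ + t)) - volume (Metric.ball c' ρ) :=
        measure_sdiff hsub' measurableSet_ball.nullMeasurableSet measure_ball_lt_top.ne
    _ = ENNReal.ofReal (((ρ + t) ^ n - ρ ^ n) *
          volume.real (Metric.ball (0 : EuclideanSpace ℝ (Fin n)) 1)) := by
        rw [volume_ball_eq_ofReal _ hρ, volume_ball_eq_ofReal _ (by linarith), ← ENNReal.ofReal_sub _ (by positivity), sub_mul]
    _ ≤ _ := by
        rw [← mul_assoc t]
        exact ENNReal.ofReal_le_ofReal (mul_le_mul_of_nonneg_right hpow measureReal_nonneg)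

/-- The volumes gained and lost in a ball by a translation differ by a boundary term. -/
theorem abs_volume_gain_sub_loss_le {E : Set (EuclideanSpace ℝ (Fin n))} (hE : MeasurableSet E)
    {x₀ z : EuclideanSpace ℝ (Fin n)} {ρ t : ℝ} (hρ : 0 < ρ) (hz : ‖z‖ ≤ t) (ht : t ≤ ρ) :
    |volume.real (Metric.ball x₀ ρ ∩ (((fun x => x - z) ⁻¹' E) \ E)) -
      volume.real (Metric.ball x₀ ρ ∩ (E \ ((fun x => x - z) ⁻¹' E)))| ≤
      t * (n * (2 * ρ) ^ (n - 1) * volume.real (Metric.ball (0 : EuclideanSpace ℝ (Fin n)) 1)) := by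
  set E' := (fun x => x - z) ⁻¹' E with hE'
  set B := Metric.ball x₀ ρ with hB
  set N := t * (n * (2 * ρ) ^ (n - 1) * volume.real (Metric.ball (0 : EuclideanSpace ℝ (Fin n)) 1))
  have ht0 : 0 ≤ t := (norm_nonneg z).trans hz
  have hN : 0 ≤ N := by positivity
  have hE'm : MeasurableSet E' := measurable_id.sub_const z hE
  have fin : ∀ S : Set (EuclideanSpace ℝ (Fin n)), volume (B ∩ S) ≠ ⊤ := fun S =>
    ((measure_mono inter_subset_left).trans_lt measure_ball_lt_top).ne
  have split : ∀ S T : Set (EuclideanSpace ℝ (Fin n)), MeasurableSet T →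
      volume.real (B ∩ S) = volume.real (B ∩ (S ∩ T)) + volume.real (B ∩ (S \ T)) := by
    intro S T hT
    rw [← inter_assoc, ← inter_sdiff_assoc, measureReal_inter_add_sdiff₀ hT.nullMeasurableSet (fin S)]
  have e1 := split E' E hE
  have e2 := split E E' hE'm
  rw [inter_comm E E'] at e2
  -- Gain minus loss is `|B ∩ E'| - |B ∩ E|`, which compares the volume of `E` in two balls with
  -- centres at distance `‖z‖`.
  have e3 : volume.real (B ∩ E') = volume.real (Metric.ball (x₀ - z) ρ ∩ E) := by
    have : B ∩ E' = (fun x => x - z) ⁻¹' (Metric.ball (x₀ - z) ρ ∩ E) := by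
      ext x
      simp [hB, hE']
    rw [this, measureReal_def, measureReal_def]
    simp only [sub_eq_add_neg]
    rw [measure_preimage_add_right]
  have cmp : ∀ c c' : EuclideanSpace ℝ (Fin n), dist c c' ≤ t →
      volume.real (Metric.ball c ρ ∩ E) ≤ volume.real (Metric.ball c' ρ ∩ E) + N := by
    intro c c' hcc
    have h1 := volume_ball_diff_ball_le hρ hcc ht
    have h2 : Metric.ball c ρ ∩ E ⊆ (Metric.ball c' ρ ∩ E) ∪ (Metric.ball c ρ \ Metric.ball c' ρ) := by
      intro x hx
      by_cases h : x ∈ Metric.ball c' ρ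
      · exact Or.inl ⟨h, hx.2⟩
      · exact Or.inr ⟨hx.1, h⟩
    have f1 : volume (Metric.ball c' ρ ∩ E) ≠ ⊤ :=
      ((measure_mono inter_subset_left).trans_lt measure_ball_lt_top).ne
    have f2 : volume (Metric.ball c ρ \ Metric.ball c' ρ) ≠ ⊤ :=
      ((measure_mono sdiff_subset).trans_lt measure_ball_lt_top).ne
    calc volume.real (Metric.ball c ρ ∩ E) ≤ _ := measureReal_mono h2 (measure_union_ne_top f1 f2)
      _ ≤ volume.real (Metric.ball c' ρ ∩ E) +
          volume.real (Metric.ball c ρ \ Metric.ball c' ρ) := measureReal_union_le _ _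
      _ ≤ _ := by
        gcongr
        exact ENNReal.toReal_le_of_le_ofReal hN h1
  have d1 : dist (x₀ - z) x₀ ≤ t := by simpa [dist_eq_norm] using hz
  have h1 := cmp _ _ d1
  have h2 := cmp _ _ (by rwa [dist_comm] at d1)
  rw [abs_le]
  constructor <;> linarith

/-- The sum is the absolute difference plus twice the minimum, and the square of the minimum is at
most the product. -/
theorem add_le_of_mul_le_of_abs_sub_le {a d t M N : ℝ} (ha : 0 ≤ a) (hd : 0 ≤ d) (ht : 0 ≤ t)
    (hmul : a * d ≤ t ^ 2 * M) (hsub : |a - d| ≤ t * N) : a + d ≤ t * (N + 2 * √M) := by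
  have hM : 0 ≤ t ^ 2 * M := (mul_nonneg ha hd).trans hmul
  have h1 : min a d ≤ t * √M := by
    have h2 : min a d ^ 2 ≤ t ^ 2 * M := by
      refine le_trans ?_ hmul
      rw [sq]
      exact mul_le_mul (min_le_left _ _) (min_le_right _ _) (le_min ha hd) ha
    calc min a d = √(min a d ^ 2) := (Real.sqrt_sq (le_min ha hd)).symm
      _ ≤ √(t ^ 2 * M) := Real.sqrt_le_sqrt h2
      _ = t * √M := by rw [Real.sqrt_mul (sq_nonneg t), Real.sqrt_sq ht]
  have := abs_le.1 hsub
  rcases min_cases a d with h | h <;> rw [h.1] at h1 <;> linarith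

set_option maxHeartbeats 1000000 in
/-- The infinitesimal translation estimate for stable sets. -/
theorem exists_volume_shiftDiff_le (n : ℕ) {s lam Lam : ℝ} (hs : 0 < s) (hl : 0 < lam)
    (hL : 0 < Lam) : ∃ C : ℝ, 0 < C ∧ ∀ K : EuclideanSpace ℝ (Fin n) → ℝ,
      IsKernelL2 s lam Lam K → ∀ Ω E : Set (EuclideanSpace ℝ (Fin n)), MeasurableSet Ω →
      MeasurableSet E → kernelPerimeter K Ω E < ⊤ → IsShearStable K Ω E →
      ∀ (x₀ : EuclideanSpace ℝ (Fin n)) (ρ : ℝ), 0 < ρ → Metric.ball x₀ (3 / 2 * ρ) ⊆ Ω →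
      ∀ e : EuclideanSpace ℝ (Fin n), ‖e‖ = 1 → ∀ δ : ℝ, 0 < δ → ∃ t₀ : ℝ, 0 < t₀ ∧
      ∀ t : ℝ, 0 < t → t < t₀ →
        volume.real (shiftDiff E (Metric.ball x₀ ρ) (t • e)) ≤
          t * (C * ρ ^ (n - 1) + C * √(ρ ^ ((n : ℝ) + s - 2) *
            (kernelPerimeter K (Metric.ball x₀ (3 / 2 * ρ)) E).toReal) + δ) := by
  obtain ⟨L, hbump⟩ := exists_scaled_bump n
  set ω := volume.real (Metric.ball (0 : EuclideanSpace ℝ (Fin n)) 1) with hω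
  set C₀ : ℝ := 18 * (2 ^ ((n : ℝ) + s) * Lam / lam) with hC₀
  have hC₀0 : 0 < C₀ := by positivity
  set C₁ : ℝ := n * 2 ^ (n - 1) * ω with hC₁
  set C₂ : ℝ := 2 ^ ((n : ℝ) + s) / lam * (C₀ * L ^ 2) with hC₂
  have hω0 : 0 ≤ ω := measureReal_nonneg
  have hC₂0 : 0 ≤ C₂ := by positivity
  refine ⟨C₁ + 2 * √C₂ + 1, by positivity, ?_⟩
  intro K hK Ω E hΩ hE hfin hstab x₀ ρ hρ hball e he δ hδ
  set B := Metric.ball x₀ (3 / 2 * ρ) with hB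
  have hKm := hK.measurable hs hl
  have hBfin : kernelPerimeter K B E < ⊤ :=
    (kernelPerimeter_mono hKm measurableSet_ball hΩ hE hball).trans_lt hfin
  set P := (kernelPerimeter K B E).toReal with hP
  have hP0 : 0 ≤ P := ENNReal.toReal_nonneg
  obtain ⟨g, hg, hgc, hgB, hg1, hgL⟩ := hbump x₀ ⟨ρ, hρ.le⟩ hρ
  change tsupport g ⊆ B at hgB
  change ∀ x ∈ Metric.closedBall x₀ (5 / 4 * ρ), g x = 1 at hg1
  set c : ℝ := lam / (2 * ρ) ^ ((n : ℝ) + s) with hc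
  have hc0 : 0 < c := by positivity
  -- Chosen so that the four stability errors, divided by `c`, add up to `(t δ / 2)²`; the square
  -- root, taken twice, then costs exactly `t δ`.
  set ε : ℝ := c * (δ / 2) ^ 2 / 4 with hε
  have hε0 : 0 < ε := by positivity
  obtain ⟨t₁, ht₁, hmin⟩ := hstab g hg hgc (hgB.trans hball) e ε hε0
  have hL1 : (0 : ℝ) < L + 1 := by positivity
  -- The second bound keeps `x - t • e` on the plateau of `g` for `x` in the ball of radius `ρ`; the
  -- third makes the Lipschitz constant of `t g` at most `1/2`.
  refine ⟨min t₁ (min (ρ / 4) (ρ / (2 * (L + 1)))), by positivity, fun t ht htt => ?_⟩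
  have htt1 : t < t₁ := htt.trans_le (min_le_left _ _)
  have htt2 : t < ρ / 4 := htt.trans_le ((min_le_right _ _).trans (min_le_left _ _))
  have htt3 : t < ρ / (2 * (L + 1)) := htt.trans_le ((min_le_right _ _).trans (min_le_right _ _))
  set ρ' : ℝ≥0 := ⟨ρ, hρ.le⟩ with hρ'
  set t' : ℝ≥0 := ⟨t, ht.le⟩ with ht'
  set q : ℝ≥0 := t' * (L / ρ') with hq
  have hqr : (q : ℝ) = t * (L / ρ) := rfl
  have hq2 : q ≤ 1 / 2 := by
    rw [← NNReal.coe_le_coe, hqr]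
    push_cast
    rw [lt_div_iff₀ (by positivity)] at htt3
    rw [← mul_div_assoc, div_le_iff₀ hρ]
    nlinarith
  have hq1 : q < 1 := hq2.trans_lt (by rw [← NNReal.coe_lt_coe]; push_cast; norm_num)
  have hGL : LipschitzWith q fun x => t * g x := by
    refine LipschitzWith.of_dist_le_mul fun x y => ?_
    rw [Real.dist_eq, ← mul_sub, abs_mul, abs_of_pos ht, ← Real.dist_eq, hqr, mul_assoc]
    exact mul_le_mul_of_nonneg_left (hgL.dist_le_mul x y) ht.le
  have hGd : ContDiff ℝ 1 fun x => t * g x := contDiff_const.mul (hg.of_le (by norm_num))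
  have hz : ∀ x ∉ B, g x = 0 := fun x hx => image_eq_zero_of_notMem_tsupport fun h => hx (hgB h)
  have hz' : ∀ x ∉ B, fderiv ℝ (fun x => t * g x) x = 0 := by
    intro x hx
    have h1 : x ∉ tsupport (fderiv ℝ g) := fun h => hx (hgB (tsupport_fderiv_subset ℝ h))
    rw [fderiv_const_mul (hg.differentiable (by norm_num) x), image_eq_zero_of_notMem_tsupport h1,
      smul_zero]
  have m1 := hmin t ⟨by linarith, htt1⟩
  have m2 := hmin (-t) ⟨by linarith, by linarith⟩
  rw [neg_sq] at m2
  simp only [neg_mul] at m2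
  have key := kernelInteraction_deformation_le hK hs hl hL hGL hq2 he hGd hball
    (fun x hx => by rw [hz x hx, mul_zero]) Metric.isOpen_ball hz' hΩ hE hfin m1.1 m1.2 m2.1 m2.2
  set Φ : EuclideanSpace ℝ (Fin n) → EuclideanSpace ℝ (Fin n) := fun x => x + (t * g x) • e with hΦ
  have hinj : Function.Injective Φ :=
    ((hGL.smul_unit he).idAddHomeomorph hq1).injective
  set E' := (fun x => x - t • e) ⁻¹' E with hE'
  have himg : ∀ x ∈ Metric.ball x₀ ρ, (x ∈ Φ '' E ↔ x ∈ E') := by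
    intro x hx
    have h1 : Φ (x - t • e) = x := by
      have : x - t • e ∈ Metric.closedBall x₀ (5 / 4 * ρ) := by
        rw [Metric.mem_closedBall]
        have h2 : dist (x - t • e) x = t := by
          rw [dist_eq_norm, sub_sub_cancel_left, norm_neg, norm_smul, he, mul_one,
            Real.norm_of_nonneg ht.le]
        rw [Metric.mem_ball] at hx
        linarith [dist_triangle (x - t • e) x x₀]
      rw [hΦ]
      simp only [hg1 _ this, mul_one, sub_add_cancel]
    constructor
    · rintro ⟨y, hy, hyx⟩
      have : y = x - t • e := hinj (hyx.trans h1.symm)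
      rw [hE', mem_preimage, ← this]
      exact hy
    · intro h
      exact ⟨_, h, h1⟩
  have hE'm : MeasurableSet E' := measurable_id.sub_const _ hE
  set A := Metric.ball x₀ ρ ∩ (E' \ E) with hA
  set D := Metric.ball x₀ ρ ∩ (E \ E') with hD
  have hBB : Metric.ball x₀ ρ ⊆ B := Metric.ball_subset_ball (by linarith)
  have hAm : MeasurableSet A := measurableSet_ball.inter (hE'm.diff hE)
  have hDm : MeasurableSet D := measurableSet_ball.inter (hE.diff hE'm)
  have hAsub : A ⊆ B ∩ (Φ '' E \ E) := fun x hx =>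
    ⟨hBB hx.1, (himg x hx.1).2 hx.2.1, hx.2.2⟩
  have hDsub : D ⊆ B ∩ (E \ Φ '' E) := fun x hx =>
    ⟨hBB hx.1, hx.2.1, fun h => hx.2.2 ((himg x hx.1).1 h)⟩
  have hAD : Disjoint A D := disjoint_left.2 fun x h1 h2 => h1.2.2 h2.2.1
  have low := le_kernelInteraction_of_subset_ball hK hs hl (A := A) (D := D) inter_subset_left
    inter_subset_left hAm hDm hAD
  have mono : kernelInteraction K A D ≤ kernelInteraction K (B ∩ (Φ '' E \ E)) (B ∩ (E \ Φ '' E)) := by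
    rw [kernelInteraction_eq_lintegral_prod hKm, kernelInteraction_eq_lintegral_prod hKm]
    exact lintegral_mono_set (prod_mono hAsub hDsub)
  have total := (low.trans mono).trans key
  have finA : volume A ≠ ⊤ := ((measure_mono inter_subset_left).trans_lt measure_ball_lt_top).ne
  have finD : volume D ≠ ⊤ := ((measure_mono inter_subset_left).trans_lt measure_ball_lt_top).ne
  have total' : c * (volume.real A * volume.real D) ≤ C₀ * q ^ 2 * P + 4 * (ε * t ^ 2) := by
    have rhs : ENNReal.ofReal (C₀ * q ^ 2) * kernelPerimeter K B E + 4 * ENNReal.ofReal (ε * t ^ 2)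
        = ENNReal.ofReal (C₀ * q ^ 2 * P + 4 * (ε * t ^ 2)) := by
      rw [ENNReal.ofReal_add (by positivity) (by positivity), ENNReal.ofReal_mul (by positivity)
        (q := P), hP, ENNReal.ofReal_toReal hBfin.ne, ENNReal.ofReal_mul (by norm_num) (p := 4),
        ENNReal.ofReal_ofNat]
    rw [rhs] at total
    have := ENNReal.toReal_le_of_le_ofReal (by positivity) total
    rwa [ENNReal.toReal_mul, ENNReal.toReal_mul, ENNReal.toReal_ofReal hc0.le] at this
  have hmul : volume.real A * volume.real D ≤
      t ^ 2 * (C₂ * (ρ ^ ((n : ℝ) + s - 2) * P) + (δ / 2) ^ 2) := by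
    have h1 : ρ ^ ((n : ℝ) + s) = ρ ^ ((n : ℝ) + s - 2) * ρ ^ 2 := by
      rw [Real.rpow_sub hρ, Real.rpow_ofNat]
      field_simp
    have h2 : c * (t ^ 2 * (C₂ * (ρ ^ ((n : ℝ) + s - 2) * P) + (δ / 2) ^ 2)) =
        C₀ * q ^ 2 * P + 4 * (ε * t ^ 2) := by
      rw [hε, hqr, hC₂, hc, Real.mul_rpow (by norm_num) hρ.le, h1]
      have : 0 < ρ ^ ((n : ℝ) + s - 2) := Real.rpow_pos_of_pos hρ _
      field_simp
    rw [← h2] at total'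
    exact le_of_mul_le_mul_left total' hc0
  have hsub := abs_volume_gain_sub_loss_le hE (x₀ := x₀) (z := t • e) (t := t) hρ
    (by rw [norm_smul, he, mul_one, Real.norm_of_nonneg ht.le]) (by linarith)
  have fin := add_le_of_mul_le_of_abs_sub_le measureReal_nonneg measureReal_nonneg ht.le hmul hsub
  have hS : shiftDiff E (Metric.ball x₀ ρ) (t • e) = A ∪ D := by
    rw [shiftDiff, hA, hD, ← inter_union_distrib_left]
    rfl
  rw [hS, measureReal_union hAD hDm finA finD]
  refine fin.trans (mul_le_mul_of_nonneg_left ?_ ht.le)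
  set Y := ρ ^ ((n : ℝ) + s - 2) * P
  have hY : 0 ≤ Y := by positivity
  have hsqrt : √(C₂ * Y + (δ / 2) ^ 2) ≤ √C₂ * √Y + δ / 2 := by
    rw [← Real.sqrt_mul hC₂0, Real.sqrt_le_left (by positivity), add_sq,
      Real.sq_sqrt (by positivity)]
    have := mul_nonneg (Real.sqrt_nonneg (C₂ * Y)) hδ.le
    linarith
  have hN : (n : ℝ) * (2 * ρ) ^ (n - 1) * ω = C₁ * ρ ^ (n - 1) := by rw [hC₁, mul_pow]; ring
  rw [hN]
  have hC₁0 : 0 ≤ C₁ := by positivity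
  have p1 : 0 ≤ ρ ^ (n - 1) := by positivity
  have p2 := Real.sqrt_nonneg Y
  have p3 := Real.sqrt_nonneg C₂
  nlinarith [mul_nonneg p3 p1, mul_nonneg hC₁0 p2]

end Shift

/-! ### Finite translations and the local energy -/

section Energy

open scoped NNReal

variable {n : ℕ}

theorem volume_shiftDiff_nsmul_le {E B B' : Set (EuclideanSpace ℝ (Fin n))}
    {w : EuclideanSpace ℝ (Fin n)} (N : ℕ)
    (hB : ∀ k < N, ∀ x ∈ B', x - (k : ℝ) • w ∈ B) :
    volume (shiftDiff E B' ((N : ℝ) • w)) ≤ N * volume (shiftDiff E B w) := by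
  induction N with
  | zero => simp [shiftDiff]
  | succ N ih =>
    -- If `χ_E` differs at the two ends of a chain of steps `w`, it differs across the first `N`
    -- steps or across the last one.
    have hsub : shiftDiff E B' (((N + 1 : ℕ) : ℝ) • w) ⊆ shiftDiff E B' ((N : ℝ) • w) ∪
        (fun x => x + -((N : ℝ) • w)) ⁻¹' shiftDiff E B w := by
      intro x hx
      have e1 : x - ((N + 1 : ℕ) : ℝ) • w = x - (N : ℝ) • w - w := by
        push_cast; module
      have h1 := hB N (Nat.lt_succ_self N) x hx.1
      have h2 := hx.1
      have h3 := hx.2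
      simp only [shiftDiff, mem_union, mem_inter_iff, mem_symmDiff, mem_preimage, e1,
        ← sub_eq_add_neg] at h3 ⊢
      tauto
    refine (measure_mono hsub).trans ((measure_union_le _ _).trans ?_)
    rw [measure_preimage_add_right, Nat.cast_succ, add_mul, one_mul]
    exact add_le_add (ih fun k hk => hB k (hk.trans (Nat.lt_succ_self N))) le_rfl

/-- The translation is cut into `N` equal steps short enough for the hypothesis. Since the bound is
linear in the step, the pieces add up with no loss in `M`, and the intermediate points stay in the
larger ball because `r ≤ ρ / 2`. -/
theorem volume_shiftDiff_le_of_infinitesimal {E : Set (EuclideanSpace ℝ (Fin n))}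
    {x₀ e : EuclideanSpace ℝ (Fin n)} {ρ r M : ℝ} (he : ‖e‖ = 1) (hr : 0 ≤ r) (hrρ : r ≤ ρ / 2)
    (h : ∀ δ : ℝ, 0 < δ → ∃ t₀ : ℝ, 0 < t₀ ∧ ∀ t : ℝ, 0 < t → t < t₀ →
      volume.real (shiftDiff E (Metric.ball x₀ ρ) (t • e)) ≤ t * (M + δ)) :
    volume.real (shiftDiff E (Metric.ball x₀ (ρ / 2)) (r • e)) ≤ r * M := by
  rcases hr.eq_or_lt with rfl | hr0
  · simp [shiftDiff]
  have fin : ∀ (R : ℝ) (w : EuclideanSpace ℝ (Fin n)),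
      volume (shiftDiff E (Metric.ball x₀ R) w) ≠ ⊤ := fun R w =>
    ((measure_mono inter_subset_left).trans_lt measure_ball_lt_top).ne
  refine le_of_forall_pos_le_add fun δ hδ => ?_
  obtain ⟨t₀, ht₀, H⟩ := h (δ / r) (by positivity)
  obtain ⟨N, hN⟩ := exists_nat_gt (r / t₀)
  have hN0 : (0 : ℝ) < N := (by positivity : 0 < r / t₀).trans hN
  have h1 := H (r / N) (by positivity) (by rwa [div_lt_comm₀ hN0 ht₀])
  have h2 := volume_shiftDiff_nsmul_le (E := E) (B := Metric.ball x₀ ρ)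
    (B' := Metric.ball x₀ (ρ / 2)) (w := (r / N) • e) N (by
      intro k hk x hx
      have hk' : (k : ℝ) ≤ N := by exact_mod_cast hk.le
      rw [Metric.mem_ball] at hx ⊢
      have h3 : dist (x - (k : ℝ) • (r / N) • e) x ≤ r := by
        rw [dist_eq_norm, sub_sub_cancel_left, norm_neg, norm_smul, norm_smul, he, mul_one,
          Real.norm_of_nonneg (by positivity), Real.norm_of_nonneg (by positivity),
          mul_div_assoc', div_le_iff₀ hN0]
        nlinarith
      linarith [dist_triangle (x - (k : ℝ) • (r / N) • e) x x₀])
  rw [smul_smul, mul_div_cancel₀ _ hN0.ne'] at h2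
  have h4 := ENNReal.toReal_mono (ENNReal.mul_ne_top (ENNReal.natCast_ne_top N) (fin _ _)) h2
  rw [ENNReal.toReal_mul, ENNReal.toReal_natCast] at h4
  calc volume.real (shiftDiff E (Metric.ball x₀ (ρ / 2)) (r • e))
      ≤ N * volume.real (shiftDiff E (Metric.ball x₀ ρ) ((r / N) • e)) := h4
    _ ≤ N * (r / N * (M + δ / r)) := by gcongr
    _ = r * M + δ := by field_simp

/-- The density `x ↦ ∫ |χ_E(x) - χ_E(y)| K(x - y) dy` of the nonlocal energy. -/
noncomputable def energyDensity (K : EuclideanSpace ℝ (Fin n) → ℝ)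
    (E : Set (EuclideanSpace ℝ (Fin n))) (x : EuclideanSpace ℝ (Fin n)) : ENNReal :=
  ∫⁻ y in {y | ¬(x ∈ E ↔ y ∈ E)}, ENNReal.ofReal (K (x - y))

theorem measurableSet_mem_iff {E : Set (EuclideanSpace ℝ (Fin n))} (hE : MeasurableSet E)
    (x : EuclideanSpace ℝ (Fin n)) : MeasurableSet {y | ¬(x ∈ E ↔ y ∈ E)} := by
  by_cases hx : x ∈ E
  · simp only [hx, true_iff]; exact hE.compl
  · simp only [hx, false_iff, not_not]; exact hE

theorem measurable_energyDensity {K : EuclideanSpace ℝ (Fin n) → ℝ} (hK : Measurable K)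
    {E : Set (EuclideanSpace ℝ (Fin n))} (hE : MeasurableSet E) :
    Measurable (energyDensity K E) := by
  have hS : MeasurableSet {p : EuclideanSpace ℝ (Fin n) × EuclideanSpace ℝ (Fin n) |
      ¬(p.1 ∈ E ↔ p.2 ∈ E)} := by
    have : {p : EuclideanSpace ℝ (Fin n) × EuclideanSpace ℝ (Fin n) | ¬(p.1 ∈ E ↔ p.2 ∈ E)} =
        symmDiff (Prod.fst ⁻¹' E) (Prod.snd ⁻¹' E) := by
      ext p
      simp only [mem_symmDiff, mem_preimage, mem_ofPred_eq]
      tauto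
    rw [this]
    exact (measurable_fst hE).symmDiff (measurable_snd hE)
  have hk : Measurable fun p : EuclideanSpace ℝ (Fin n) × EuclideanSpace ℝ (Fin n) =>
      ENNReal.ofReal (K (p.1 - p.2)) :=
    (hK.comp (measurable_fst.sub measurable_snd)).ennreal_ofReal
  have h := (hk.indicator hS).lintegral_prod_right' (ν := volume)
  convert h using 2 with x
  rw [energyDensity, ← lintegral_indicator (measurableSet_mem_iff hE x)]
  rfl

theorem kernelInteraction_comm {K : EuclideanSpace ℝ (Fin n) → ℝ} (hK : Measurable K)
    (heven : ∀ z, K z = K (-z)) (A B : Set (EuclideanSpace ℝ (Fin n))) :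
    kernelInteraction K A B = kernelInteraction K B A := by
  rw [kernelInteraction, lintegral_lintegral_swap]
  · refine lintegral_congr fun y => lintegral_congr fun x => ?_
    rw [heven, neg_sub]
  · exact (hK.comp (measurable_fst.sub measurable_snd)).ennreal_ofReal.aemeasurable

theorem setLIntegral_energyDensity {K : EuclideanSpace ℝ (Fin n) → ℝ}
    {E : Set (EuclideanSpace ℝ (Fin n))} (hE : MeasurableSet E)
    {A : Set (EuclideanSpace ℝ (Fin n))} (hA : MeasurableSet A) :
    ∫⁻ x in A, energyDensity K E x =
      kernelInteraction K (A ∩ E) Eᶜ + kernelInteraction K (A \ E) E := by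
  rw [← lintegral_inter_add_sdiff _ A hE]
  congr 1
  · refine setLIntegral_congr_fun (hA.inter hE) fun x hx => ?_
    have : {y | ¬(x ∈ E ↔ y ∈ E)} = Eᶜ := by ext y; simp [hx.2]
    simp only [energyDensity, this]
  · refine setLIntegral_congr_fun (hA.diff hE) fun x hx => ?_
    have : {y | ¬(x ∈ E ↔ y ∈ E)} = E := by ext y; simp [hx.2]
    simp only [energyDensity, this]

/-- The perimeter in `A` is not additive in `A`, whereas the integral of `energyDensity` is a
measure. The two agree up to a factor `2`, since pairs with both points in `A` are counted twice by
the measure. -/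
theorem kernelPerimeter_le_lintegral_energyDensity {K : EuclideanSpace ℝ (Fin n) → ℝ}
    (hK : Measurable K) (heven : ∀ z, K z = K (-z)) {E A : Set (EuclideanSpace ℝ (Fin n))}
    (hE : MeasurableSet E) (hA : MeasurableSet A) :
    kernelPerimeter K A E ≤ ∫⁻ x in A, energyDensity K E x := by
  rw [setLIntegral_energyDensity hE hA, kernelInteraction_comm hK heven (A \ E) E,
    kernelPerimeter_eq_lintegral hK hA hE, kernelInteraction_eq_lintegral_prod hK,
    kernelInteraction_eq_lintegral_prod hK]
  refine le_trans (lintegral_mono_set ?_) (lintegral_union_le _ _ _)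
  rintro p ⟨⟨h1, h2⟩, h3⟩
  simp only [mem_union, mem_prod, mem_inter_iff, mem_sdiff, mem_compl_iff]
  tauto

theorem lintegral_energyDensity_le_two_mul {K : EuclideanSpace ℝ (Fin n) → ℝ}
    (hK : Measurable K) (heven : ∀ z, K z = K (-z)) {E A : Set (EuclideanSpace ℝ (Fin n))}
    (hE : MeasurableSet E) (hA : MeasurableSet A) :
    ∫⁻ x in A, energyDensity K E x ≤ 2 * kernelPerimeter K A E := by
  rw [setLIntegral_energyDensity hE hA, kernelInteraction_comm hK heven (A \ E) E, two_mul,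
    kernelPerimeter_eq_lintegral hK hA hE, kernelInteraction_eq_lintegral_prod hK,
    kernelInteraction_eq_lintegral_prod hK]
  refine add_le_add (lintegral_mono_set fun p hp => ?_) (lintegral_mono_set fun p hp => ?_)
  · exact ⟨⟨hp.1.2, hp.2⟩, Or.inl hp.1.1⟩
  · exact ⟨⟨hp.1, hp.2.2⟩, Or.inr hp.2.1⟩

theorem energyDensity_eq_lintegral_shift (K : EuclideanSpace ℝ (Fin n) → ℝ)
    {E : Set (EuclideanSpace ℝ (Fin n))} (hE : MeasurableSet E) (x : EuclideanSpace ℝ (Fin n)) :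
    energyDensity K E x =
      ∫⁻ z, {z | ¬(x ∈ E ↔ x - z ∈ E)}.indicator (fun z => ENNReal.ofReal (K z)) z := by
  rw [energyDensity, ← lintegral_indicator (measurableSet_mem_iff hE x),
    ← lintegral_sub_left_eq_self _ x]
  refine lintegral_congr fun z => ?_
  classical
  simp only [indicator_apply, mem_ofPred_eq, sub_sub_cancel]

theorem lintegral_energyDensity_eq {K : EuclideanSpace ℝ (Fin n) → ℝ}
    (hK : Measurable K) {E A : Set (EuclideanSpace ℝ (Fin n))}
    (hE : MeasurableSet E) :
    ∫⁻ x in A, energyDensity K E x =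
      ∫⁻ z, ENNReal.ofReal (K z) * volume (shiftDiff E A z) := by
  have hS : MeasurableSet {p : EuclideanSpace ℝ (Fin n) × EuclideanSpace ℝ (Fin n) |
      ¬(p.1 ∈ E ↔ p.1 - p.2 ∈ E)} := by
    have : {p : EuclideanSpace ℝ (Fin n) × EuclideanSpace ℝ (Fin n) | ¬(p.1 ∈ E ↔ p.1 - p.2 ∈ E)} =
        symmDiff (Prod.fst ⁻¹' E) ((fun p => p.1 - p.2) ⁻¹' E) := by
      ext p
      simp only [mem_symmDiff, mem_preimage, mem_ofPred_eq]
      tauto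
    rw [this]
    exact (measurable_fst hE).symmDiff ((measurable_fst.sub measurable_snd) hE)
  have hk : Measurable fun p : EuclideanSpace ℝ (Fin n) × EuclideanSpace ℝ (Fin n) =>
      ENNReal.ofReal (K p.2) := (hK.comp measurable_snd).ennreal_ofReal
  simp_rw [energyDensity_eq_lintegral_shift K hE]
  -- Integrating first in `x` for a fixed displacement `z` produces the translation differences
  -- estimated above.
  rw [lintegral_lintegral_swap]
  · refine lintegral_congr fun z => ?_
    have hm : MeasurableSet (symmDiff ((fun x => x - z) ⁻¹' E) E) :=
      (measurable_id.sub_const z hE).symmDiff hE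
    have : ∀ x, {z | ¬(x ∈ E ↔ x - z ∈ E)}.indicator (fun z => ENNReal.ofReal (K z)) z =
        (symmDiff ((fun x => x - z) ⁻¹' E) E).indicator (fun _ => ENNReal.ofReal (K z)) x := by
      intro x
      classical
      simp only [indicator_apply, mem_ofPred_eq, mem_symmDiff, mem_preimage]
      congr 1
      rw [eq_iff_iff]
      tauto
    simp_rw [this]
    rw [lintegral_indicator hm, setLIntegral_const, Measure.restrict_apply hm, inter_comm]
    rfl
  · exact (hk.indicator hS).aemeasurable

theorem lintegral_norm_eq [Nontrivial (EuclideanSpace ℝ (Fin n))] {f : ℝ → ℝ}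
    (hf : ∀ y, 0 ≤ y → 0 ≤ f y) (hi : IntegrableOn (fun y : ℝ => y ^ (n - 1) * f y) (Ioi 0)) :
    ∫⁻ z : EuclideanSpace ℝ (Fin n), ENNReal.ofReal (f ‖z‖) =
      ENNReal.ofReal (n * volume.real (Metric.ball (0 : EuclideanSpace ℝ (Fin n)) 1) *
        ∫ y in Ioi (0 : ℝ), y ^ (n - 1) * f y) := by
  have hint : Integrable (fun z : EuclideanSpace ℝ (Fin n) => f ‖z‖) := by
    rw [integrable_fun_norm_addHaar]
    simpa using hi
  rw [← ofReal_integral_eq_lintegral_ofReal hint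
    (Filter.Eventually.of_forall fun z => hf _ (norm_nonneg z)), integral_fun_norm_addHaar]
  simp [mul_assoc]

theorem setLIntegral_norm_rpow [Nontrivial (EuclideanSpace ℝ (Fin n))] (hn : 1 ≤ n)
    {T : Set ℝ} (hT : MeasurableSet T) {a b : ℝ} (hab : b = a + (n - 1))
    (hi : IntegrableOn (fun y : ℝ => y ^ b) (Ioi 0 ∩ T)) :
    ∫⁻ z in {z : EuclideanSpace ℝ (Fin n) | ‖z‖ ∈ T}, ENNReal.ofReal (‖z‖ ^ a) =
      ENNReal.ofReal (n * volume.real (Metric.ball (0 : EuclideanSpace ℝ (Fin n)) 1) *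
        ∫ y in Ioi 0 ∩ T, y ^ b) := by
  have e1 : EqOn (fun y : ℝ => y ^ (n - 1) * T.indicator (fun y => y ^ a) y)
      (T.indicator fun y : ℝ => y ^ b) (Ioi 0) := by
    intro y hy
    have hy' : 0 < y := hy
    by_cases hyT : y ∈ T
    · simp only [indicator_of_mem hyT]
      rw [← Real.rpow_natCast, ← Real.rpow_add hy', Nat.cast_sub hn, hab]
      congr 1; push_cast; ring
    · simp only [indicator_of_notMem hyT, mul_zero]
  have h := lintegral_norm_eq (n := n) (f := T.indicator (fun y => y ^ a)) (fun y hy => by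
    by_cases hyT : y ∈ T
    · rw [indicator_of_mem hyT]; exact Real.rpow_nonneg hy a
    · rw [indicator_of_notMem hyT]) (by
    rw [integrableOn_congr_fun e1 measurableSet_Ioi, IntegrableOn, integrable_indicator_iff hT,
      IntegrableOn, Measure.restrict_restrict hT, inter_comm]
    exact hi)
  rw [setIntegral_congr_fun measurableSet_Ioi e1, setIntegral_indicator hT] at h
  have hm : MeasurableSet {z : EuclideanSpace ℝ (Fin n) | ‖z‖ ∈ T} := measurable_norm hT
  rw [← h, ← lintegral_indicator hm]
  refine lintegral_congr fun z => ?_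
  by_cases hz : ‖z‖ ∈ T
  · rw [indicator_of_mem hz, indicator_of_mem (show z ∈ {z | ‖z‖ ∈ T} from hz)]
  · rw [indicator_of_notMem hz, indicator_of_notMem (show z ∉ {z | ‖z‖ ∈ T} from hz),
      ENNReal.ofReal_zero]

theorem setLIntegral_norm_lt_rpow [Nontrivial (EuclideanSpace ℝ (Fin n))] (hn : 1 ≤ n) {s r : ℝ}
    (hs : s < 1) (hr : 0 < r) :
    ∫⁻ z in {z : EuclideanSpace ℝ (Fin n) | ‖z‖ ∈ Iio r},
        ENNReal.ofReal (‖z‖ ^ (1 - ((n : ℝ) + s))) =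
      ENNReal.ofReal (n * volume.real (Metric.ball (0 : EuclideanSpace ℝ (Fin n)) 1) *
        (r ^ (1 - s) / (1 - s))) := by
  have hi0 : IntegrableOn (fun y : ℝ => y ^ (-s)) (Ioo 0 r) :=
    (intervalIntegral.integrableOn_Ioo_rpow_iff hr).2 (by linarith)
  rw [setLIntegral_norm_rpow hn measurableSet_Iio (b := -s) (by ring)
    (by rwa [Ioi_inter_Iio]), Ioi_inter_Iio, ← integral_Ioc_eq_integral_Ioo,
    ← intervalIntegral.integral_of_le hr.le, integral_rpow (Or.inl (by linarith)),
    Real.zero_rpow (by linarith), sub_zero, neg_add_eq_sub]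

theorem setLIntegral_le_norm_rpow [Nontrivial (EuclideanSpace ℝ (Fin n))] (hn : 1 ≤ n)
    {s r : ℝ} (hs : 0 < s) (hr : 0 < r) :
    ∫⁻ z in {z : EuclideanSpace ℝ (Fin n) | ‖z‖ ∈ Ici r},
        ENNReal.ofReal (‖z‖ ^ (-((n : ℝ) + s))) =
      ENNReal.ofReal (n * volume.real (Metric.ball (0 : EuclideanSpace ℝ (Fin n)) 1) *
        (r ^ (-s) / s)) := by
  have hsub : Ioi 0 ∩ Ici r = Ici r := inter_eq_right.2 fun y hy => hr.trans_le hy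
  have hi0 : IntegrableOn (fun y : ℝ => y ^ (-s - 1)) (Ici r) := by
    rw [integrableOn_Ici_iff_integrableOn_Ioi]
    exact integrableOn_Ioi_rpow_of_lt (by linarith) hr
  rw [setLIntegral_norm_rpow hn measurableSet_Ici (b := -s - 1) (by ring) (by rwa [hsub]), hsub,
    integral_Ici_eq_integral_Ioi, integral_Ioi_rpow_of_lt (by linarith) hr, sub_add_cancel,
    neg_div_neg_eq]

/-- The energy in a ball, in terms of a Lipschitz bound for the translations. -/
theorem lintegral_energyDensity_ball_le (hn : 1 ≤ n) {s lam Lam : ℝ} (hs : 0 < s)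
    (hs1 : s < 1) (hl : 0 < lam) {K : EuclideanSpace ℝ (Fin n) → ℝ} (hK : IsKernelL2 s lam Lam K)
    {E : Set (EuclideanSpace ℝ (Fin n))} (hE : MeasurableSet E) {x₀ : EuclideanSpace ℝ (Fin n)}
    {r M : ℝ} (hr : 0 < r) (hM : 0 ≤ M) (hL : 0 < Lam)
    (h : ∀ z : EuclideanSpace ℝ (Fin n), ‖z‖ ≤ r →
      volume.real (shiftDiff E (Metric.ball x₀ r) z) ≤ ‖z‖ * M) :
    ∫⁻ x in Metric.ball x₀ r, energyDensity K E x ≤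
      ENNReal.ofReal (Lam * (n * volume.real (Metric.ball (0 : EuclideanSpace ℝ (Fin n)) 1)) *
        (M * (r ^ (1 - s) / (1 - s)) +
          volume.real (Metric.ball (0 : EuclideanSpace ℝ (Fin n)) 1) * (r ^ ((n : ℝ) - s) / s))) := by
  have : Nonempty (Fin n) := ⟨⟨0, hn⟩⟩
  have : Nontrivial (EuclideanSpace ℝ (Fin n)) := inferInstance
  set ω := volume.real (Metric.ball (0 : EuclideanSpace ℝ (Fin n)) 1)
  have hω : 0 ≤ ω := measureReal_nonneg
  have fin : ∀ z : EuclideanSpace ℝ (Fin n), volume (shiftDiff E (Metric.ball x₀ r) z) ≠ ⊤ :=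
    fun z => ((measure_mono inter_subset_left).trans_lt measure_ball_lt_top).ne
  have hvol : volume (Metric.ball x₀ r) = ENNReal.ofReal (r ^ n * ω) :=
    volume_ball_eq_ofReal x₀ hr
  have hmeas : MeasurableSet {z : EuclideanSpace ℝ (Fin n) | ‖z‖ ∈ Iio r} :=
    measurable_norm measurableSet_Iio
  have hcompl : {z : EuclideanSpace ℝ (Fin n) | ‖z‖ ∈ Iio r}ᶜ = {z | ‖z‖ ∈ Ici r} := by
    ext z; simp
  have near : ∫⁻ z in {z : EuclideanSpace ℝ (Fin n) | ‖z‖ ∈ Iio r},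
      ENNReal.ofReal (K z) * volume (shiftDiff E (Metric.ball x₀ r) z) ≤
      ENNReal.ofReal (Lam * M) * ENNReal.ofReal (n * ω * (r ^ (1 - s) / (1 - s))) := by
    rw [← setLIntegral_norm_lt_rpow hn hs1 hr, ← lintegral_const_mul' _ _ ENNReal.ofReal_ne_top]
    refine setLIntegral_mono' hmeas fun z hz => ?_
    rcases eq_or_ne z 0 with rfl | hz0
    · simp [shiftDiff]
    have hz' : 0 < ‖z‖ := norm_pos_iff.2 hz0
    rw [← ENNReal.ofReal_toReal (fin z), ← ENNReal.ofReal_mul (hK.nonneg hl hz0),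
      ← ENNReal.ofReal_mul (by positivity)]
    refine ENNReal.ofReal_le_ofReal ?_
    calc K z * volume.real (shiftDiff E (Metric.ball x₀ r) z)
        ≤ Lam / ‖z‖ ^ ((n : ℝ) + s) * (‖z‖ * M) :=
          mul_le_mul (hK.upper z hz0) (h z (le_of_lt hz)) measureReal_nonneg (by positivity)
      _ = _ := by
        rw [Real.rpow_sub hz', Real.rpow_one]; ring
  have far : ∫⁻ z in {z : EuclideanSpace ℝ (Fin n) | ‖z‖ ∈ Iio r}ᶜ,
      ENNReal.ofReal (K z) * volume (shiftDiff E (Metric.ball x₀ r) z) ≤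
      ENNReal.ofReal (Lam * (r ^ n * ω)) * ENNReal.ofReal (n * ω * (r ^ (-s) / s)) := by
    rw [← setLIntegral_le_norm_rpow hn hs hr, ← lintegral_const_mul' _ _ ENNReal.ofReal_ne_top,
      hcompl]
    refine setLIntegral_mono' (hcompl ▸ hmeas.compl) fun z hz => ?_
    have hz' : 0 < ‖z‖ := hr.trans_le hz
    have hz0 : z ≠ 0 := norm_pos_iff.1 hz'
    calc ENNReal.ofReal (K z) * volume (shiftDiff E (Metric.ball x₀ r) z)
        ≤ ENNReal.ofReal (Lam / ‖z‖ ^ ((n : ℝ) + s)) * ENNReal.ofReal (r ^ n * ω) := by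
          rw [← hvol]
          exact mul_le_mul' (ENNReal.ofReal_le_ofReal (hK.upper z hz0))
            (measure_mono inter_subset_left)
      _ = _ := by
        rw [← ENNReal.ofReal_mul (by positivity), ← ENNReal.ofReal_mul (by positivity),
          Real.rpow_neg hz'.le]
        congr 1; ring
  rw [lintegral_energyDensity_eq (hK.measurable hs hl) hE,
    ← lintegral_add_compl _ hmeas]
  refine (add_le_add near far).trans (le_of_eq ?_)
  have h1s : 0 < 1 - s := by linarith
  rw [← ENNReal.ofReal_mul (by positivity), ← ENNReal.ofReal_mul (by positivity),
    ← ENNReal.ofReal_add (by positivity) (by positivity)]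
  congr 1
  rw [sub_eq_add_neg (n : ℝ) s, Real.rpow_add hr, Real.rpow_natCast]
  ring

/-- The energy of a stable set in a ball is at most a small multiple of the energy in a larger
ball, up to a constant. -/
theorem exists_energy_ball_le (hn : 1 ≤ n) {s lam Lam : ℝ} (hs : 0 < s) (hs1 : s < 1)
    (hl : 0 < lam) (hL : 0 < Lam) : ∃ C : ℝ, 0 < C ∧ ∀ K : EuclideanSpace ℝ (Fin n) → ℝ,
      IsKernelL2 s lam Lam K → ∀ Ω E : Set (EuclideanSpace ℝ (Fin n)), MeasurableSet Ω →
      MeasurableSet E → kernelPerimeter K Ω E < ⊤ → IsShearStable K Ω E →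
      ∀ (x₀ : EuclideanSpace ℝ (Fin n)) (ρ η : ℝ), 0 < ρ → 0 < η →
      Metric.ball x₀ (3 / 2 * ρ) ⊆ Ω →
      ∫⁻ x in Metric.ball x₀ (ρ / 2), energyDensity K E x ≤
        ENNReal.ofReal (C * (1 + 1 / η) * ρ ^ ((n : ℝ) - s)) +
          ENNReal.ofReal η * ∫⁻ x in Metric.ball x₀ (3 / 2 * ρ), energyDensity K E x := by
  obtain ⟨C, hC, H⟩ := exists_volume_shiftDiff_le n hs hl hL
  set ω := volume.real (Metric.ball (0 : EuclideanSpace ℝ (Fin n)) 1)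
  have hω : 0 ≤ ω := measureReal_nonneg
  have h1s : 0 < 1 - s := by linarith
  set a := Lam * (n * ω) * C / (1 - s) with ha
  set b := Lam * (n * ω) * ω / s with hb
  have ha0 : 0 ≤ a := by positivity
  have hb0 : 0 ≤ b := by positivity
  refine ⟨a + b + a ^ 2 + 1, by positivity, ?_⟩
  intro K hK Ω E hΩ hE hfin hstab x₀ ρ η hρ hη hball
  have hKm := hK.measurable hs hl
  set P := kernelPerimeter K (Metric.ball x₀ (3 / 2 * ρ)) E with hP
  have hPfin : P < ⊤ := (kernelPerimeter_mono hKm measurableSet_ball hΩ hE hball).trans_lt hfin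
  set p := P.toReal with hp
  have hp0 : 0 ≤ p := ENNReal.toReal_nonneg
  set Q := √(ρ ^ ((n : ℝ) + s - 2) * p) with hQ
  set M := C * ρ ^ (n - 1) + C * Q with hM
  have hM0 : 0 ≤ M := by positivity
  have hshift : ∀ z : EuclideanSpace ℝ (Fin n), ‖z‖ ≤ ρ / 2 →
      volume.real (shiftDiff E (Metric.ball x₀ (ρ / 2)) z) ≤ ‖z‖ * M := by
    intro z hz
    rcases eq_or_ne z 0 with rfl | hz0
    · simp [shiftDiff]
    have hz' : ‖z‖ ≠ 0 := norm_ne_zero_iff.2 hz0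
    have he : ‖(‖z‖⁻¹ • z)‖ = 1 := by rw [norm_smul, norm_inv, norm_norm, inv_mul_cancel₀ hz']
    have := volume_shiftDiff_le_of_infinitesimal he (norm_nonneg z) hz
      (H K hK Ω E hΩ hE hfin hstab x₀ ρ hρ hball _ he)
    rwa [smul_smul, mul_inv_cancel₀ hz', one_smul] at this
  refine (lintegral_energyDensity_ball_le hn hs hs1 hl hK hE (half_pos hρ) hM0 hL hshift).trans ?_
  have hPle : ENNReal.ofReal η * ENNReal.ofReal p ≤
      ENNReal.ofReal η * ∫⁻ x in Metric.ball x₀ (3 / 2 * ρ), energyDensity K E x := by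
    rw [hp, ENNReal.ofReal_toReal hPfin.ne]
    exact mul_le_mul_right (kernelPerimeter_le_lintegral_energyDensity hKm hK.even hE
      measurableSet_ball) _
  refine le_trans ?_ (add_le_add le_rfl hPle)
  rw [← ENNReal.ofReal_mul hη.le, ← ENNReal.ofReal_add (by positivity) (by positivity)]
  refine ENNReal.ofReal_le_ofReal ?_
  set Z := ρ ^ ((n : ℝ) - s) with hZ
  have hZ0 : 0 < Z := Real.rpow_pos_of_pos hρ _
  have r1 : (ρ / 2) ^ (1 - s) ≤ ρ ^ (1 - s) := by gcongr; linarith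
  have r2 : (ρ / 2) ^ ((n : ℝ) - s) ≤ Z := by
    have : (1 : ℝ) ≤ n := by exact_mod_cast hn
    refine Real.rpow_le_rpow (by positivity) (by linarith) (by linarith)
  have r3 : ρ ^ (n - 1) * ρ ^ (1 - s) = Z := by
    rw [← Real.rpow_natCast, ← Real.rpow_add hρ, Nat.cast_sub hn, hZ]
    congr 1; push_cast; ring
  -- The powers of `ρ` combine so that the square root is the geometric mean of the target `ρ^{n-s}`
  -- and the energy; Young's inequality then applies with any `η`.
  have r4 : Q * ρ ^ (1 - s) = √(Z * p) := by
    have : ρ ^ (1 - s) = √(ρ ^ (2 * (1 - s))) := by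
      rw [mul_comm, Real.rpow_mul hρ.le, Real.rpow_ofNat, Real.sqrt_sq (by positivity)]
    rw [hQ, this, ← Real.sqrt_mul (by positivity), mul_right_comm, ← Real.rpow_add hρ, hZ]
    congr 3; ring
  have r5 : a * √(Z * p) ≤ a ^ 2 / η * Z + η * p := by
    have h1 : √(Z * p) = √(Z / η) * √(η * p) := by
      rw [← Real.sqrt_mul (by positivity)]
      congr 1; field_simp
    have h2 := Real.sq_sqrt (show 0 ≤ Z / η by positivity)
    have h3 := Real.sq_sqrt (show 0 ≤ η * p by positivity)
    have h4 : a ^ 2 / η * Z = a ^ 2 * (Z / η) := by ring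
    rw [h1, h4]
    nlinarith [sq_nonneg (a * √(Z / η) - √(η * p)), sq_nonneg (a * √(Z / η) + √(η * p)),
      mul_nonneg ha0 (mul_nonneg (Real.sqrt_nonneg (Z / η)) (Real.sqrt_nonneg (η * p)))]
  calc Lam * (n * ω) * (M * ((ρ / 2) ^ (1 - s) / (1 - s)) + ω * ((ρ / 2) ^ ((n : ℝ) - s) / s))
      ≤ Lam * (n * ω) * (M * (ρ ^ (1 - s) / (1 - s)) + ω * (Z / s)) := by gcongr
    _ = a * (ρ ^ (n - 1) * ρ ^ (1 - s)) + a * (Q * ρ ^ (1 - s)) + b * Z := by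
        rw [ha, hb, hM]; ring
    _ = a * Z + a * √(Z * p) + b * Z := by rw [r3, r4]
    _ ≤ a * Z + (a ^ 2 / η * Z + η * p) + b * Z := by gcongr
    _ ≤ (a + b + a ^ 2 + 1) * (1 + 1 / η) * Z + η * p := by
        have h1 : a ^ 2 / η = a ^ 2 * (1 / η) := by ring
        have h2 : 0 ≤ 1 / η := by positivity
        rw [h1]
        nlinarith [mul_nonneg (mul_nonneg ha0 h2) hZ0.le, mul_nonneg (mul_nonneg hb0 h2) hZ0.le,
          mul_nonneg h2 hZ0.le, mul_nonneg (sq_nonneg a) hZ0.le]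

end Energy

/-! ### Absorption of the energy in larger balls -/

section Absorption

variable {n : ℕ}

theorem lintegral_weighted_ball_eq {f w : EuclideanSpace ℝ (Fin n) → ENNReal} (hf : Measurable f)
    (hw : Measurable w) {r : EuclideanSpace ℝ (Fin n) → ℝ} (hr : Measurable r)
    (Ω : Set (EuclideanSpace ℝ (Fin n))) :
    ∫⁻ x in Ω, w x * ∫⁻ y in Metric.ball x (r x), f y =
      ∫⁻ y, ∫⁻ x in Ω, {x | dist y x < r x}.indicator (fun x => w x * f y) x := by
  have hS : MeasurableSet {p : EuclideanSpace ℝ (Fin n) × EuclideanSpace ℝ (Fin n) |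
      dist p.2 p.1 < r p.1} :=
    measurableSet_lt (measurable_snd.dist measurable_fst) (hr.comp measurable_fst)
  rw [lintegral_lintegral_swap]
  · refine lintegral_congr fun x => ?_
    rw [← lintegral_const_mul _ hf, ← lintegral_indicator measurableSet_ball]
    rfl
  · have h : Measurable fun p : EuclideanSpace ℝ (Fin n) × EuclideanSpace ℝ (Fin n) =>
        w p.1 * f p.2 := (hw.comp measurable_fst).mul (hf.comp measurable_snd)
    exact ((h.indicator hS).comp measurable_swap).aemeasurable

/-- With `D = 2R - ‖y‖`, every centre `x` within `D / 16` of `y` has its small ball reaching `y`,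
and its weight is at least `(2D)^{s-n}` since `s < n`. The volume `~ D^n` of these centres yields
`D^s`. -/
theorem absorption_lower {s R : ℝ} (hs1 : s < 1) (hn : 1 ≤ n)
    {f : EuclideanSpace ℝ (Fin n) → ENNReal} {y : EuclideanSpace ℝ (Fin n)}
    (hy : y ∈ Metric.ball (0 : EuclideanSpace ℝ (Fin n)) (2 * R)) :
    ENNReal.ofReal (2 ^ (s - n) / 16 ^ n *
        volume.real (Metric.ball (0 : EuclideanSpace ℝ (Fin n)) 1)) *
        (ENNReal.ofReal ((2 * R - ‖y‖) ^ s) * f y) ≤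
      ∫⁻ x in Metric.ball (0 : EuclideanSpace ℝ (Fin n)) (2 * R),
        {x | dist y x < (2 * R - ‖x‖) / 8}.indicator
          (fun x => ENNReal.ofReal ((2 * R - ‖x‖) ^ (s - n)) * f y) x := by
  set ω := volume.real (Metric.ball (0 : EuclideanSpace ℝ (Fin n)) 1)
  have hω : 0 ≤ ω := measureReal_nonneg
  rw [mem_ball_zero_iff] at hy
  set D := 2 * R - ‖y‖ with hD
  have hD0 : 0 < D := by rw [hD]; linarith
  have hn' : (1 : ℝ) ≤ n := by exact_mod_cast hn
  have close : ∀ x ∈ Metric.ball y (D / 16), |‖x‖ - ‖y‖| < D / 16 := fun x hx => by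
    rw [Metric.mem_ball, dist_eq_norm] at hx
    exact (abs_norm_sub_norm_le x y).trans_lt hx
  have hsub : Metric.ball y (D / 16) ⊆ Metric.ball (0 : EuclideanSpace ℝ (Fin n)) (2 * R) := by
    intro x hx
    rw [mem_ball_zero_iff]
    have := abs_lt.1 (close x hx)
    linarith
  refine le_trans ?_ (lintegral_mono_set hsub)
  have h1 : ∫⁻ _ in Metric.ball y (D / 16), ENNReal.ofReal ((2 * D) ^ (s - n)) * f y ≤
      ∫⁻ x in Metric.ball y (D / 16), {x | dist y x < (2 * R - ‖x‖) / 8}.indicator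
          (fun x => ENNReal.ofReal ((2 * R - ‖x‖) ^ (s - n)) * f y) x := by
    refine setLIntegral_mono' measurableSet_ball fun x hx => ?_
    have hx' := abs_lt.1 (close x hx)
    have hmem : x ∈ {x | dist y x < (2 * R - ‖x‖) / 8} := by
      rw [Metric.mem_ball, dist_comm] at hx
      change dist y x < (2 * R - ‖x‖) / 8
      linarith
    rw [indicator_of_mem hmem]
    gcongr ?_ * _
    refine ENNReal.ofReal_le_ofReal (Real.rpow_le_rpow_of_nonpos ?_ ?_ ?_) <;> linarith
  refine le_trans (le_of_eq ?_) h1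
  rw [setLIntegral_const, volume_ball_eq_ofReal _ (by positivity), mul_right_comm, ← mul_assoc,
    ← ENNReal.ofReal_mul (by positivity), ← ENNReal.ofReal_mul (by positivity)]
  congr 2
  have : D ^ s = D ^ (s - n) * D ^ n := by
    rw [← Real.rpow_natCast, ← Real.rpow_add hD0, sub_add_cancel]
  rw [this, Real.mul_rpow (by norm_num) hD0.le, div_pow]
  ring

/-- If the larger ball around `x` contains `y`, the boundary distances of `x` and `y` are
comparable. Hence `x` lies within `D` of `y`, its weight is at most `(D / 2)^{s-n}`, and `y` is
inside the big ball. -/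
theorem absorption_upper {s R : ℝ} (hs1 : s < 1) (hn : 1 ≤ n)
    {f : EuclideanSpace ℝ (Fin n) → ENNReal} (y : EuclideanSpace ℝ (Fin n)) :
    ∫⁻ x in Metric.ball (0 : EuclideanSpace ℝ (Fin n)) (2 * R),
        {x | dist y x < 3 / 8 * (2 * R - ‖x‖)}.indicator
          (fun x => ENNReal.ofReal ((2 * R - ‖x‖) ^ (s - n)) * f y) x ≤
    (Metric.ball (0 : EuclideanSpace ℝ (Fin n)) (2 * R)).indicator (fun y =>
      ENNReal.ofReal (2 ^ (n - s) * volume.real (Metric.ball (0 : EuclideanSpace ℝ (Fin n)) 1)) *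
        (ENNReal.ofReal ((2 * R - ‖y‖) ^ s) * f y)) y := by
  set ω := volume.real (Metric.ball (0 : EuclideanSpace ℝ (Fin n)) 1)
  have hω : 0 ≤ ω := measureReal_nonneg
  set D := 2 * R - ‖y‖ with hD
  have hn' : (1 : ℝ) ≤ n := by exact_mod_cast hn
  have close : ∀ x, dist y x < 3 / 8 * (2 * R - ‖x‖) → |‖y‖ - ‖x‖| < 3 / 8 * (2 * R - ‖x‖) :=
    fun x hx => by
      rw [dist_eq_norm] at hx
      exact (abs_norm_sub_norm_le y x).trans_lt hx
  by_cases hy : y ∈ Metric.ball (0 : EuclideanSpace ℝ (Fin n)) (2 * R)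
  · rw [indicator_of_mem hy]
    have hD0 : 0 < D := by rw [mem_ball_zero_iff] at hy; rw [hD]; linarith
    have h1 : ∫⁻ x in Metric.ball (0 : EuclideanSpace ℝ (Fin n)) (2 * R),
        {x | dist y x < 3 / 8 * (2 * R - ‖x‖)}.indicator
          (fun x => ENNReal.ofReal ((2 * R - ‖x‖) ^ (s - n)) * f y) x ≤
        ∫⁻ x, (Metric.ball y D).indicator
          (fun _ => ENNReal.ofReal ((D / 2) ^ (s - n)) * f y) x := by
      refine (setLIntegral_le_lintegral _ _).trans (lintegral_mono fun x => ?_)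
      by_cases hx : x ∈ {x | dist y x < 3 / 8 * (2 * R - ‖x‖)}
      · have hx' := abs_lt.1 (close x hx)
        have hx'' : dist y x < 3 / 8 * (2 * R - ‖x‖) := hx
        have hxD : x ∈ Metric.ball y D := by
          rw [Metric.mem_ball, dist_comm]
          linarith
        rw [indicator_of_mem hx, indicator_of_mem hxD]
        gcongr ?_ * _
        refine ENNReal.ofReal_le_ofReal (Real.rpow_le_rpow_of_nonpos ?_ ?_ ?_) <;> linarith
      · rw [indicator_of_notMem hx]
        exact zero_le
    refine h1.trans (le_of_eq ?_)
    rw [lintegral_indicator measurableSet_ball, setLIntegral_const,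
      volume_ball_eq_ofReal _ (by positivity), mul_right_comm, ← mul_assoc,
      ← ENNReal.ofReal_mul (by positivity), ← ENNReal.ofReal_mul (by positivity)]
    congr 2
    have : D ^ s = D ^ (s - n) * D ^ n := by
      rw [← Real.rpow_natCast, ← Real.rpow_add hD0, sub_add_cancel]
    rw [this, Real.div_rpow hD0.le (by norm_num), ← neg_sub (n : ℝ) s,
      Real.rpow_neg (by norm_num : (0 : ℝ) ≤ 2)]
    field_simp
    rfl
  · rw [indicator_of_notMem hy]
    refine le_of_eq (lintegral_eq_zero_of_ae_eq_zero (Filter.Eventually.of_forall fun x => ?_))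
    refine indicator_of_notMem (fun hx => hy ?_) _
    have := abs_lt.1 (close x hx)
    have h0 : 0 < 3 / 8 * (2 * R - ‖x‖) := dist_nonneg.trans_lt hx
    rw [mem_ball_zero_iff]
    linarith

/-- A measure whose mass in small balls is controlled by a small fraction of the mass in larger
balls, up to a power of the radius, has controlled mass in the interior. -/
theorem exists_absorption (hn : 1 ≤ n) {s : ℝ} (hs : 0 < s) (hs1 : s < 1) {C : ℝ} (hC : 0 < C) :
    ∃ C' : ℝ, 0 < C' ∧ ∀ (f : EuclideanSpace ℝ (Fin n) → ENNReal) (R : ℝ), Measurable f → 0 < R →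
      ∫⁻ x in Metric.ball (0 : EuclideanSpace ℝ (Fin n)) (2 * R), f x < ⊤ →
      (∀ (x₀ : EuclideanSpace ℝ (Fin n)) (ρ η : ℝ), 0 < ρ → 0 < η →
        Metric.ball x₀ (3 / 2 * ρ) ⊆ Metric.ball 0 (2 * R) →
        ∫⁻ x in Metric.ball x₀ (ρ / 2), f x ≤
          ENNReal.ofReal (C * (1 + 1 / η) * ρ ^ ((n : ℝ) - s)) +
            ENNReal.ofReal η * ∫⁻ x in Metric.ball x₀ (3 / 2 * ρ), f x) →
      ∫⁻ x in Metric.ball (0 : EuclideanSpace ℝ (Fin n)) (3 / 2 * R), f x ≤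
        ENNReal.ofReal (C' * R ^ ((n : ℝ) - s)) := by
  set ω := volume.real (Metric.ball (0 : EuclideanSpace ℝ (Fin n)) 1) with hω_def
  have hω : 0 < ω := by
    rw [hω_def, measureReal_def]
    exact ENNReal.toReal_pos (Metric.measure_ball_pos _ _ one_pos).ne' measure_ball_lt_top.ne
  set c₁ : ℝ := 2 ^ (s - n) / 16 ^ n * ω with hc₁
  set c₂ : ℝ := 2 ^ (n - s) * ω with hc₂
  have hc₁0 : 0 < c₁ := by positivity
  have hc₂0 : 0 < c₂ := by positivity
  -- The larger balls then return exactly half of the lower bound `c₁ J`.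
  set η := c₁ / (2 * c₂) with hη
  have hη0 : 0 < η := by positivity
  set A : ℝ := C * (1 + 1 / η) * 4 ^ (s - n) with hA
  have hA0 : 0 < A := by positivity
  have hn' : (1 : ℝ) ≤ n := by exact_mod_cast hn
  refine ⟨2 ^ s * (2 / c₁ * (A * (2 ^ n * ω))), by positivity, ?_⟩
  intro f R hf hR hfin hyp
  set Ω := Metric.ball (0 : EuclideanSpace ℝ (Fin n)) (2 * R) with hΩ
  have hd : Measurable fun x : EuclideanSpace ℝ (Fin n) => 2 * R - ‖x‖ :=
    measurable_norm.const_sub _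
  have hw : Measurable fun x : EuclideanSpace ℝ (Fin n) =>
      ENNReal.ofReal ((2 * R - ‖x‖) ^ (s - n)) := (hd.pow_const _).ennreal_ofReal
  have hds : Measurable fun x : EuclideanSpace ℝ (Fin n) =>
      ENNReal.ofReal ((2 * R - ‖x‖) ^ s) * f x := (hd.pow_const _).ennreal_ofReal.mul hf
  set J := ∫⁻ y in Ω, ENNReal.ofReal ((2 * R - ‖y‖) ^ s) * f y with hJ
  -- Subtracting half of `J` from both sides requires finiteness, and this is where the finite
  -- energy in the large ball enters.
  have hJfin : J ≠ ⊤ := by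
    have h1 : J ≤ ∫⁻ y in Ω, ENNReal.ofReal ((2 * R) ^ s) * f y := by
      refine setLIntegral_mono' measurableSet_ball fun y hy => ?_
      rw [hΩ, mem_ball_zero_iff] at hy
      gcongr
      linarith [norm_nonneg y]
    rw [lintegral_const_mul _ hf] at h1
    exact (h1.trans_lt (ENNReal.mul_lt_top ENNReal.ofReal_lt_top hfin)).ne
  have low : ENNReal.ofReal c₁ * J ≤ ∫⁻ x in Ω, ENNReal.ofReal ((2 * R - ‖x‖) ^ (s - n)) *
      ∫⁻ y in Metric.ball x ((2 * R - ‖x‖) / 8), f y := by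
    rw [lintegral_weighted_ball_eq hf hw (hd.div_const 8), hJ, ← lintegral_const_mul _ hds]
    exact (setLIntegral_mono' measurableSet_ball fun y hy => absorption_lower hs1 hn hy).trans
      (setLIntegral_le_lintegral _ _)
  have up : ∫⁻ x in Ω, ENNReal.ofReal ((2 * R - ‖x‖) ^ (s - n)) *
      ∫⁻ y in Metric.ball x (3 / 8 * (2 * R - ‖x‖)), f y ≤ ENNReal.ofReal c₂ * J := by
    rw [lintegral_weighted_ball_eq hf hw (hd.const_mul (3 / 8)), hJ, ← lintegral_const_mul _ hds,
      ← lintegral_indicator measurableSet_ball]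
    exact lintegral_mono fun y => absorption_upper hs1 hn y
  have mid : ∫⁻ x in Ω, ENNReal.ofReal ((2 * R - ‖x‖) ^ (s - n)) *
      ∫⁻ y in Metric.ball x ((2 * R - ‖x‖) / 8), f y ≤
      ENNReal.ofReal A * volume Ω + ENNReal.ofReal η *
        ∫⁻ x in Ω, ENNReal.ofReal ((2 * R - ‖x‖) ^ (s - n)) *
          ∫⁻ y in Metric.ball x (3 / 8 * (2 * R - ‖x‖)), f y := by
    rw [← lintegral_const_mul' _ _ ENNReal.ofReal_ne_top, ← setLIntegral_const,
      ← lintegral_add_left measurable_const]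
    refine setLIntegral_mono' measurableSet_ball fun x hx => ?_
    rw [hΩ, mem_ball_zero_iff] at hx
    set D := 2 * R - ‖x‖ with hD
    have hD0 : 0 < D := by rw [hD]; linarith
    -- The weight `D^{s-n}` exactly cancels the error `(D / 4)^{n-s}` up to a constant, so the error
    -- integrates to a multiple of the volume.
    have h1 := hyp x (D / 4) η (by positivity) hη0 (by
      refine Metric.ball_subset_ball' ?_
      rw [dist_zero_right]; linarith)
    rw [show D / 4 / 2 = D / 8 by ring, show 3 / 2 * (D / 4) = 3 / 8 * D by ring] at h1
    refine (mul_le_mul_right h1 _).trans (le_of_eq ?_)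
    rw [mul_add, ← ENNReal.ofReal_mul (by positivity), mul_left_comm _ (ENNReal.ofReal η)]
    congr 2
    rw [hA, Real.div_rpow hD0.le (by norm_num), ← neg_sub (n : ℝ) s, Real.rpow_neg hD0.le,
      Real.rpow_neg (by norm_num : (0 : ℝ) ≤ 4)]
    have : D ^ ((n : ℝ) - s) ≠ 0 := (Real.rpow_pos_of_pos hD0 _).ne'
    field_simp
  have hvol : volume Ω = ENNReal.ofReal ((2 * R) ^ n * ω) := volume_ball_eq_ofReal 0 (by positivity)
  have tot := (low.trans mid).trans (add_le_add le_rfl (mul_le_mul_right up _))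
  set j := J.toReal with hj
  have hj0 : 0 ≤ j := ENNReal.toReal_nonneg
  have hJj : J = ENNReal.ofReal j := (ENNReal.ofReal_toReal hJfin).symm
  rw [hvol, hJj, ← ENNReal.ofReal_mul (by positivity), ← ENNReal.ofReal_mul (by positivity),
    ← ENNReal.ofReal_mul (by positivity), ← ENNReal.ofReal_mul (by positivity),
    ← ENNReal.ofReal_add (by positivity) (by positivity),
    ENNReal.ofReal_le_ofReal_iff (by positivity)] at tot
  have hηc : η * (c₂ * j) = c₁ * j / 2 := by rw [hη]; field_simp
  have hjle : j ≤ 2 / c₁ * (A * ((2 * R) ^ n * ω)) := by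
    rw [div_mul_eq_mul_div, le_div_iff₀ hc₁0]
    linarith
  have hsub : Metric.ball (0 : EuclideanSpace ℝ (Fin n)) (3 / 2 * R) ⊆ Ω :=
    Metric.ball_subset_ball (by linarith)
  have hfin' : ENNReal.ofReal ((R / 2) ^ s) *
      ∫⁻ x in Metric.ball (0 : EuclideanSpace ℝ (Fin n)) (3 / 2 * R), f x ≤ J := by
    rw [← lintegral_const_mul _ hf]
    refine le_trans (setLIntegral_mono' measurableSet_ball fun x hx => ?_) (lintegral_mono_set hsub)
    rw [mem_ball_zero_iff] at hx
    gcongr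
    linarith
  have hRs : 0 < (R / 2) ^ s := by positivity
  have h2 : ∫⁻ x in Metric.ball (0 : EuclideanSpace ℝ (Fin n)) (3 / 2 * R), f x ≤
      ENNReal.ofReal (j / (R / 2) ^ s) := by
    rw [ENNReal.ofReal_div_of_pos hRs, ← hJj, ENNReal.le_div_iff_mul_le
      (Or.inl (ENNReal.ofReal_pos.2 hRs).ne') (Or.inl ENNReal.ofReal_ne_top), mul_comm]
    exact hfin'
  refine h2.trans (ENNReal.ofReal_le_ofReal ?_)
  rw [div_le_iff₀ hRs]
  refine hjle.trans (le_of_eq ?_)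
  rw [Real.rpow_sub hR, Real.rpow_natCast, Real.div_rpow hR.le (by norm_num), mul_pow]
  have : 0 < R ^ s := by positivity
  field_simp

end Absorption

/-! ### The classical perimeter -/

section ClassicalPerimeter

open Filter Topology

variable {n : ℕ}

/-- Difference quotients bound the distributional derivative. -/
theorem setIntegral_fderiv_le_of_infinitesimal {E B : Set (EuclideanSpace ℝ (Fin n))}
    (hE : MeasurableSet E) (hB : MeasurableSet B) (hBfin : volume B ≠ ⊤)
    {e : EuclideanSpace ℝ (Fin n)} {M : ℝ}
    (h : ∀ δ : ℝ, 0 < δ → ∃ t₀ : ℝ, 0 < t₀ ∧ ∀ t : ℝ, 0 < t → t < t₀ →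
      volume.real (shiftDiff E B (t • e)) ≤ t * (M + δ))
    {ψ : EuclideanSpace ℝ (Fin n) → ℝ} (hψ : ContDiff ℝ 1 ψ) (hψc : HasCompactSupport ψ)
    (hψB : tsupport ψ ⊆ B) (hψ1 : ∀ x, |ψ x| ≤ 1) :
    ∫ x in E, fderiv ℝ ψ x e ≤ M := by
  have hψi : Integrable ψ := hψ.continuous.integrable_of_hasCompactSupport hψc
  have quot : ∀ t : ℝ, 0 < t →
      ∫ x in E, t⁻¹ * (ψ (x + t • e) - ψ x) ≤ t⁻¹ * volume.real (shiftDiff E B (t • e)) := by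
    intro t ht
    set E' := (fun x => x - t • e) ⁻¹' E with hE'
    have hE'm : MeasurableSet E' := measurable_id.sub_const _ hE
    have hSm : MeasurableSet (shiftDiff E B (t • e)) := hB.inter (hE'm.symmDiff hE)
    have hSfin : volume (shiftDiff E B (t • e)) ≠ ⊤ :=
      ((measure_mono inter_subset_left).trans_lt hBfin.lt_top).ne
    -- Moving the difference quotient from `ψ` to `χ_E` leaves an integrand bounded by `1` and
    -- supported where `χ_E` and its translate differ in `B`.
    have hshift : ∫ x in E, ψ (x + t • e) = ∫ x in E', ψ x := by
      rw [← integral_indicator hE, ← integral_indicator hE'm,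
        ← integral_add_right_eq_self (E'.indicator ψ) (t • e)]
      congr 1
      ext x
      by_cases hx : x ∈ E
      · rw [indicator_of_mem hx, indicator_of_mem (show x + t • e ∈ E' by
          rw [hE', mem_preimage, add_sub_cancel_right]; exact hx)]
      · rw [indicator_of_notMem hx, indicator_of_notMem (show x + t • e ∉ E' by
          rw [hE', mem_preimage, add_sub_cancel_right]; exact hx)]
    rw [integral_const_mul, integral_sub (hψi.comp_add_right _).integrableOn hψi.integrableOn,
      hshift]
    refine mul_le_mul_of_nonneg_left ?_ (inv_pos.2 ht).le
    rw [← integral_indicator hE, ← integral_indicator hE'm,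
      ← integral_sub (hψi.indicator hE'm) (hψi.indicator hE), ← integral_indicator_one hSm]
    refine integral_mono ((hψi.indicator hE'm).sub (hψi.indicator hE))
      ((integrable_indicator_iff hSm).2 (integrableOn_const hSfin)) fun x => ?_
    have b := abs_le.1 (hψ1 x)
    by_cases hxB : x ∈ B
    · by_cases h1 : x ∈ E <;> by_cases h2 : x ∈ E' <;>
        simp only [shiftDiff, indicator, mem_inter_iff, mem_symmDiff, hxB, h1, h2, ← hE'] <;>
        norm_num <;> linarith
    · have : ψ x = 0 := image_eq_zero_of_notMem_tsupport fun h => hxB (hψB h)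
      have hx : x ∉ shiftDiff E B (t • e) := fun h => hxB h.1
      rw [indicator_of_notMem hx]
      by_cases h1 : x ∈ E <;> by_cases h2 : x ∈ E' <;> simp [indicator, h1, h2, this]
  have lim : Tendsto (fun t : ℝ => ∫ x in E, t⁻¹ * (ψ (x + t • e) - ψ x)) (𝓝[>] 0)
      (𝓝 (∫ x in E, fderiv ℝ ψ x e)) := by
    obtain ⟨L, hL⟩ := hψ.lipschitzWith_of_hasCompactSupport hψc (by norm_num)
    -- For `0 < t < 1` all difference quotients vanish outside this compact set, so a constant on
    -- `S` dominates them.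
    set S := Metric.cthickening ‖e‖ (tsupport ψ) with hS
    have hSc : IsCompact S := hψc.isCompact.cthickening
    have hbound : IntegrableOn (S.indicator fun _ => (L : ℝ) * ‖e‖) E :=
      ((integrable_indicator_iff hSc.measurableSet).2
        (integrableOn_const hSc.measure_lt_top.ne)).integrableOn
    refine tendsto_integral_filter_of_dominated_convergence _ ?_ ?_ hbound ?_
    · refine Eventually.of_forall fun t => Continuous.aestronglyMeasurable ?_
      exact continuous_const.mul
        ((hψ.continuous.comp (continuous_id.add continuous_const)).sub hψ.continuous)
    · have h1 : ∀ᶠ t : ℝ in 𝓝[>] 0, t < 1 := nhdsWithin_le_nhds (gt_mem_nhds one_pos)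
      filter_upwards [h1, self_mem_nhdsWithin] with t ht1 ht0
      have ht0' : 0 < t := ht0
      refine Eventually.of_forall fun x => ?_
      by_cases hx : x ∈ S
      · rw [indicator_of_mem hx, norm_mul, norm_inv, Real.norm_of_nonneg ht0'.le,
          inv_mul_le_iff₀ ht0', ← dist_eq_norm]
        refine (hL.dist_le_mul _ _).trans (le_of_eq ?_)
        rw [dist_eq_norm, add_sub_cancel_left, norm_smul, Real.norm_of_nonneg ht0'.le]
        ring
      · have z1 : ψ x = 0 := image_eq_zero_of_notMem_tsupport fun h =>
          hx (Metric.self_subset_cthickening _ h)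
        have z2 : ψ (x + t • e) = 0 := image_eq_zero_of_notMem_tsupport fun h => by
          refine hx (Metric.mem_cthickening_of_dist_le x (x + t • e) _ _ h ?_)
          rw [dist_eq_norm, sub_add_cancel_left, norm_neg, norm_smul, Real.norm_of_nonneg ht0'.le]
          nlinarith [norm_nonneg e]
        rw [z1, z2, indicator_of_notMem hx, sub_zero, mul_zero, norm_zero]
    · refine Eventually.of_forall fun x => ?_
      have hd : HasDerivAt (fun t : ℝ => ψ (x + t • e)) (fderiv ℝ ψ x e) 0 :=
        ((hψ.differentiable (by norm_num) x).hasFDerivAt.hasLineDerivAt e)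
      have := hd.tendsto_slope_zero_right
      simpa using this
  refine le_of_forall_pos_le_add fun δ hδ => ?_
  obtain ⟨t₀, ht₀, H⟩ := h δ hδ
  refine le_of_tendsto lim ?_
  have h1 : ∀ᶠ t : ℝ in 𝓝[>] 0, t < t₀ := nhdsWithin_le_nhds (gt_mem_nhds ht₀)
  filter_upwards [h1, self_mem_nhdsWithin] with t ht1 ht0
  have ht0' : 0 < t := ht0
  refine (quot t ht0).trans ?_
  rw [inv_mul_le_iff₀ ht0']
  exact H t ht0 ht1

/-- Each of the `n` components of a test field is a scalar test function bounded by `1`, paired with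
one coordinate derivative; hence the factor `n`. -/
theorem classicalPerimeter_le_of_infinitesimal {E B : Set (EuclideanSpace ℝ (Fin n))}
    (hE : MeasurableSet E) (hB : MeasurableSet B) (hBfin : volume B ≠ ⊤) {M : ℝ}
    (h : ∀ e : EuclideanSpace ℝ (Fin n), ‖e‖ = 1 → ∀ δ : ℝ, 0 < δ → ∃ t₀ : ℝ, 0 < t₀ ∧
      ∀ t : ℝ, 0 < t → t < t₀ → volume.real (shiftDiff E B (t • e)) ≤ t * (M + δ)) :
    classicalPerimeter B E ≤ ENNReal.ofReal (n * M) := by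
  refine iSup_le fun ⟨φ, hφ⟩ => ENNReal.ofReal_le_ofReal ?_
  have hcomp : ∀ i : Fin n, ContDiff ℝ 1 fun x => φ x i := fun i =>
    (EuclideanSpace.proj (𝕜 := ℝ) i).contDiff.comp hφ.contDiff
  have hts : ∀ i : Fin n, tsupport (fun x => φ x i) ⊆ tsupport φ := fun i =>
    closure_mono fun x hx h0 => hx (by simp only [h0, PiLp.zero_apply])
  have hcs : ∀ i : Fin n, HasCompactSupport fun x => φ x i := fun i =>
    hφ.hasCompactSupport.mono' ((subset_tsupport _).trans (hts i))
  have hder : ∀ (i : Fin n) (x v : EuclideanSpace ℝ (Fin n)),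
      (fderiv ℝ φ x v) i = fderiv ℝ (fun x => φ x i) x v := by
    intro i x v
    have h1 := (EuclideanSpace.proj (𝕜 := ℝ) i).hasFDerivAt.comp x
      (hφ.contDiff.differentiable (by norm_num) x).hasFDerivAt
    have h2 : fderiv ℝ (fun x => φ x i) x = _ := h1.fderiv
    rw [h2]; rfl
  have hint : ∀ i : Fin n, Integrable fun x =>
      fderiv ℝ (fun x => φ x i) x (EuclideanSpace.single i 1) := fun i => by
    refine Continuous.integrable_of_hasCompactSupport ?_ ?_
    · exact ((hcomp i).continuous_fderiv (by norm_num)).clm_apply continuous_const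
    · exact (hcs i).fderiv_apply (𝕜 := ℝ) _
  have e1 : ∫ x in B, E.indicator (fun _ => (1 : ℝ)) x * vectorDivergence φ x =
      ∑ i : Fin n, ∫ x in E, fderiv ℝ (fun x => φ x i) x (EuclideanSpace.single i 1) := by
    rw [setIntegral_eq_integral_of_forall_compl_eq_zero, ← integral_finsetSum _ fun i _ =>
      (hint i).integrableOn, ← integral_indicator hE]
    · congr 1
      ext x
      by_cases hx : x ∈ E
      · simp only [indicator_of_mem hx, one_mul, vectorDivergence, hder]
      · simp only [indicator_of_notMem hx, zero_mul]
    · intro x hx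
      have h1 : x ∉ tsupport (fderiv ℝ φ) := fun h =>
        hx (hφ.tsupport_subset (tsupport_fderiv_subset ℝ h))
      simp [vectorDivergence, image_eq_zero_of_notMem_tsupport h1]
  rw [e1]
  calc ∑ i : Fin n, ∫ x in E, fderiv ℝ (fun x => φ x i) x (EuclideanSpace.single i 1)
      ≤ ∑ _i : Fin n, M := by
        refine Finset.sum_le_sum fun i _ => ?_
        refine setIntegral_fderiv_le_of_infinitesimal hE hB hBfin
          (h _ (by simp)) (hcomp i) (hcs i) ((hts i).trans hφ.tsupport_subset) fun x => ?_
        exact (PiLp.norm_apply_le (φ x) i).trans (hφ.norm_le_one x)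
    _ = n * M := by simp

theorem classicalPerimeter_congr_ae {Ω E E' : Set (EuclideanSpace ℝ (Fin n))}
    (h : E =ᵐ[volume] E') : classicalPerimeter Ω E = classicalPerimeter Ω E' := by
  refine iSup_congr fun φ => ?_
  congr 1
  refine integral_congr_ae (ae_restrict_of_ae ?_)
  filter_upwards [indicator_ae_eq_of_ae_eq_set (f := fun _ => (1 : ℝ)) h] with x hx
  rw [hx]

end ClassicalPerimeter

/-! ### The fractional kernel -/

section FractionalKernel

open Filter Topology

variable {n : ℕ}

theorem hasDerivAt_norm_line_rpow {E : Type*} [NormedAddCommGroup E] [InnerProductSpace ℝ E]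
    {z : E} (hz : z ≠ 0) (e : E) (a : ℝ) :
    HasDerivAt (fun t : ℝ => ‖z + t • e‖ ^ a) (a * inner ℝ z e * ‖z‖ ^ (a - 2)) 0 := by
  have hz' : 0 < ‖z‖ := norm_pos_iff.2 hz
  have h1 : HasDerivAt (fun t : ℝ => z + t • e) e 0 := by
    simpa using ((hasDerivAt_id (0 : ℝ)).smul_const e).const_add z
  have h2 := h1.norm_sq
  have h3 := h2.rpow_const (p := a / 2) (Or.inl (by simp [hz]))
  have e1 : ∀ t : ℝ, (‖z + t • e‖ ^ 2) ^ (a / 2) = ‖z + t • e‖ ^ a := fun t => by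
    rw [← Real.rpow_natCast, ← Real.rpow_mul (norm_nonneg _)]
    congr 1; push_cast; ring
  have e2 : (‖z‖ ^ 2) ^ (a / 2 - 1) = ‖z‖ ^ (a - 2) := by
    rw [← Real.rpow_natCast, ← Real.rpow_mul (norm_nonneg _)]
    congr 1; push_cast; ring
  simp only [e1, zero_smul, add_zero, e2] at h3
  convert h3 using 1
  ring

theorem isKernelL2_fractionalKernel {s : ℝ} (hs : 0 < s) :
    IsKernelL2 s 1 (((n : ℝ) + s) * ((n : ℝ) + s + 3) + 1) (fractionalKernel n s) := by
  set p : ℝ := (n : ℝ) + s with hp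
  have hp0 : 0 < p := by positivity
  have hfk : ∀ z : EuclideanSpace ℝ (Fin n), fractionalKernel n s z = ‖z‖ ^ (-p) := fun z => by
    rw [fractionalKernel, Real.rpow_neg (norm_nonneg _), one_div]
  have d1 : ∀ z : EuclideanSpace ℝ (Fin n), z ≠ 0 → ∀ e,
      HasLineDerivAt ℝ (fractionalKernel n s) (-p * inner ℝ z e * ‖z‖ ^ (-p - 2)) z e := by
    intro z hz e
    rw [HasLineDerivAt]
    simp only [hfk]
    exact hasDerivAt_norm_line_rpow hz e (-p)
  have d2 : ∀ z : EuclideanSpace ℝ (Fin n), z ≠ 0 → ∀ e, ‖e‖ = 1 →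
      HasLineDerivAt ℝ (fun y => lineDeriv ℝ (fractionalKernel n s) y e)
        (-p * (‖z‖ ^ (-p - 2) + inner ℝ z e * ((-p - 2) * inner ℝ z e * ‖z‖ ^ (-p - 2 - 2))))
        z e := by
    intro z hz e he
    have hin : HasDerivAt (fun t : ℝ => inner ℝ (z + t • e) e) 1 0 := by
      have : ∀ t : ℝ, inner ℝ (z + t • e) e = inner ℝ z e + t := fun t => by
        rw [inner_add_left, real_inner_smul_left, real_inner_self_eq_norm_sq, he]; ring
      simp only [this]
      simpa using (hasDerivAt_id (0 : ℝ)).const_add (inner ℝ z e)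
    have h1 := (hin.mul (hasDerivAt_norm_line_rpow hz e (-p - 2))).const_mul (-p)
    simp only [zero_smul, add_zero, one_mul] at h1
    rw [HasLineDerivAt]
    refine h1.congr_of_eventuallyEq ?_
    have hc : ContinuousAt (fun t : ℝ => z + t • e) 0 := by fun_prop
    have hne : ∀ᶠ t : ℝ in 𝓝 0, z + t • e ≠ 0 :=
      hc.eventually_ne (by simpa using hz)
    filter_upwards [hne] with t ht
    rw [(d1 _ ht e).lineDeriv, Pi.mul_apply]
    ring
  refine ⟨fun z => by simp [hfk], fun z _ => le_of_eq rfl, fun z hz => ?_,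
    fun z hz e _ => (d1 z hz e).lineDifferentiableAt,
    fun z hz e he => (d2 z hz e he).lineDifferentiableAt, fun z hz e he => ?_⟩
  · rw [fractionalKernel]
    gcongr
    nlinarith
  · have hz' : 0 < ‖z‖ := norm_pos_iff.2 hz
    have hi : |inner ℝ z e| ≤ ‖z‖ := by
      have := abs_real_inner_le_norm z e
      rwa [he, mul_one] at this
    have hi2 : inner ℝ z e ^ 2 ≤ ‖z‖ ^ 2 := sq_le_sq' (abs_le.1 hi).1 (abs_le.1 hi).2
    have q1 : ‖z‖ ^ 2 * ‖z‖ ^ (-p - 2) = ‖z‖ ^ (-p) := by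
      rw [← Real.rpow_natCast, ← Real.rpow_add hz']; congr 1; push_cast; ring
    have q2 : ‖z‖ ^ 2 * ‖z‖ ^ (-p - 2 - 2) = ‖z‖ ^ (-p - 2) := by
      rw [← Real.rpow_natCast, ← Real.rpow_add hz']; congr 1; push_cast; ring
    have q0 : 0 < ‖z‖ ^ (-p) := by positivity
    have q3 : 0 < ‖z‖ ^ (-p - 2) := by positivity
    have q4 : 0 < ‖z‖ ^ (-p - 2 - 2) := by positivity
    rw [(d1 z hz e).lineDeriv, (d2 z hz e he).lineDeriv, div_eq_mul_inv,
      ← Real.rpow_neg hz'.le, max_le_iff]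
    constructor
    · rw [abs_mul, abs_mul, abs_neg, abs_of_pos hp0, abs_of_pos q3]
      calc ‖z‖ * (p * |inner ℝ z e| * ‖z‖ ^ (-p - 2))
          ≤ ‖z‖ * (p * ‖z‖ * ‖z‖ ^ (-p - 2)) := by gcongr
        _ = p * (‖z‖ ^ 2 * ‖z‖ ^ (-p - 2)) := by ring
        _ = p * ‖z‖ ^ (-p) := by rw [q1]
        _ ≤ _ := by
          gcongr
          nlinarith
    -- By Cauchy–Schwarz the two terms are at most `1` and `p + 2` times `‖z‖ ^ (-p - 2)`, which
    -- explains `p + 3` in the constant.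
    · have h1 : |‖z‖ ^ (-p - 2) + inner ℝ z e * ((-p - 2) * inner ℝ z e * ‖z‖ ^ (-p - 2 - 2))| ≤
          (p + 3) * ‖z‖ ^ (-p - 2) := by
        have h2 : inner ℝ z e ^ 2 * ‖z‖ ^ (-p - 2 - 2) ≤ ‖z‖ ^ (-p - 2) := by
          rw [← q2]; gcongr
        have h3 : 0 ≤ inner ℝ z e ^ 2 * ‖z‖ ^ (-p - 2 - 2) := by positivity
        have h4 : inner ℝ z e * ((-p - 2) * inner ℝ z e * ‖z‖ ^ (-p - 2 - 2)) =
          -((p + 2) * (inner ℝ z e ^ 2 * ‖z‖ ^ (-p - 2 - 2))) := by ring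
        rw [h4, abs_le]
        constructor <;> nlinarith
      rw [abs_mul, abs_neg, abs_of_pos hp0]
      calc ‖z‖ ^ 2 * (p * |‖z‖ ^ (-p - 2) +
            inner ℝ z e * ((-p - 2) * inner ℝ z e * ‖z‖ ^ (-p - 2 - 2))|)
          ≤ ‖z‖ ^ 2 * (p * ((p + 3) * ‖z‖ ^ (-p - 2))) := by gcongr
        _ = p * (p + 3) * (‖z‖ ^ 2 * ‖z‖ ^ (-p - 2)) := by ring
        _ = p * (p + 3) * ‖z‖ ^ (-p) := by rw [q1]
        _ ≤ _ := by gcongr; linarith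

end FractionalKernel

/-! ### The main estimate -/

section Main

/-- Perimeter and energy bounds for stable sets, with the radii of the two balls comparable. -/
theorem exists_perimeter_bounds {n : ℕ} (hn : 1 ≤ n) {s lam Lam : ℝ} (hs : 0 < s) (hs1 : s < 1)
    (hl : 0 < lam) (hL : 0 < Lam) : ∃ C : ℝ, 0 < C ∧
      ∀ K : EuclideanSpace ℝ (Fin n) → ℝ, IsKernelL2 s lam Lam K →
      ∀ R R' : ℝ, 0 < R → R ≤ R' → R' ≤ 2 * R →
      ∀ E : Set (EuclideanSpace ℝ (Fin n)), NullMeasurableSet E →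
        IsStableSet K (Metric.ball 0 (2 * R')) E →
        classicalPerimeter (Metric.ball 0 R) E ≤ ENNReal.ofReal (C * R ^ (n - 1)) ∧
        kernelPerimeter K (Metric.ball 0 R) E ≤ ENNReal.ofReal (C * R ^ ((n : ℝ) - s)) := by
  obtain ⟨C₁, hC₁, H₁⟩ := exists_volume_shiftDiff_le n hs hl hL
  obtain ⟨C₂, hC₂, H₂⟩ := exists_energy_ball_le hn hs hs1 hl hL
  obtain ⟨C₃, hC₃, H₃⟩ := exists_absorption hn hs hs1 hC₂
  have hn' : (1 : ℝ) ≤ n := by exact_mod_cast hn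
  set C₄ : ℝ := C₃ * 2 ^ ((n : ℝ) - s) with hC₄
  have hC₄0 : 0 < C₄ := by positivity
  set C₅ : ℝ := n * (C₁ * (1 + √C₄)) with hC₅
  have hC₅0 : 0 ≤ C₅ := by positivity
  refine ⟨C₄ + C₅, by positivity, ?_⟩
  intro K hK R R' hR hRR hRR' E₀ hE₀ hst
  have hR' : 0 < R' := hR.trans_le hRR
  obtain ⟨E, -, hE, hEE⟩ := hE₀.exists_measurable_superset_ae_eq
  have hKm := hK.measurable hs hl
  have hfin := hst.finite
  have hshear := hst.isShearStable_of_ae_eq hEE.symm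
  rw [kernelPerimeter_congr_ae hEE.symm] at hfin
  rw [kernelPerimeter_congr_ae hEE.symm, classicalPerimeter_congr_ae hEE.symm]
  set Ω := Metric.ball (0 : EuclideanSpace ℝ (Fin n)) (2 * R') with hΩ
  have hfin' : ∫⁻ x in Ω, energyDensity K E x < ⊤ :=
    (lintegral_energyDensity_le_two_mul hKm hK.even hE measurableSet_ball).trans_lt
      (ENNReal.mul_lt_top (by norm_num) hfin)
  have habs := H₃ (energyDensity K E) R' (measurable_energyDensity hKm hE) hR' hfin'
    (H₂ K hK Ω E measurableSet_ball hE hfin hshear)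
  -- The radius `3R/2` is what the translation estimate in the ball of radius `R` has on its
  -- right-hand side; `R' ≤ 2R` converts the power of `R'` into one of `R`.
  have hP : kernelPerimeter K (Metric.ball 0 (3 / 2 * R)) E ≤
      ENNReal.ofReal (C₄ * R ^ ((n : ℝ) - s)) := by
    refine (kernelPerimeter_le_lintegral_energyDensity hKm hK.even hE measurableSet_ball).trans ?_
    refine (lintegral_mono_set (Metric.ball_subset_ball (by linarith))).trans (habs.trans ?_)
    refine ENNReal.ofReal_le_ofReal ?_
    rw [hC₄, mul_assoc, ← Real.mul_rpow (by norm_num) hR.le]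
    gcongr
    linarith
  constructor
  · set p := (kernelPerimeter K (Metric.ball 0 (3 / 2 * R)) E).toReal with hp
    have hple : p ≤ C₄ * R ^ ((n : ℝ) - s) := ENNReal.toReal_le_of_le_ofReal (by positivity) hP
    have hsqrt : √(R ^ ((n : ℝ) + s - 2) * p) ≤ √C₄ * R ^ (n - 1) := by
      have h1 : R ^ ((n : ℝ) + s - 2) * (C₄ * R ^ ((n : ℝ) - s)) = C₄ * (R ^ (n - 1)) ^ 2 := by
        rw [mul_left_comm, ← Real.rpow_add hR, ← pow_mul, ← Real.rpow_natCast]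
        congr 2
        push_cast [Nat.cast_sub hn]
        ring
      calc √(R ^ ((n : ℝ) + s - 2) * p) ≤ √(C₄ * (R ^ (n - 1)) ^ 2) := by
            rw [← h1]; gcongr
        _ = √C₄ * R ^ (n - 1) := by
            rw [Real.sqrt_mul hC₄0.le, Real.sqrt_sq (by positivity)]
    refine (classicalPerimeter_le_of_infinitesimal hE measurableSet_ball
      measure_ball_lt_top.ne fun e he => H₁ K hK Ω E measurableSet_ball hE hfin hshear 0 R hR
        (Metric.ball_subset_ball (by linarith)) e he).trans (ENNReal.ofReal_le_ofReal ?_)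
    calc (n : ℝ) * (C₁ * R ^ (n - 1) + C₁ * √(R ^ ((n : ℝ) + s - 2) * p))
        ≤ n * (C₁ * R ^ (n - 1) + C₁ * (√C₄ * R ^ (n - 1))) := by gcongr
      _ = C₅ * R ^ (n - 1) := by rw [hC₅]; ring
      _ ≤ (C₄ + C₅) * R ^ (n - 1) := by gcongr; linarith
  · refine (kernelPerimeter_mono hKm measurableSet_ball measurableSet_ball hE
      (Metric.ball_subset_ball (by linarith))).trans (hP.trans (ENNReal.ofReal_le_ofReal ?_))
    gcongr
    linarith

end Main

theorem mainTheorem3 (n : ℕ) (hn : 2 ≤ n) (s : ℝ) (hs : s ∈ Set.Ioo (0 : ℝ) 1) :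
    (∀ lam Lam : ℝ, 0 < lam → ∃ C : ℝ, 0 < C ∧
      ∀ K : EuclideanSpace ℝ (Fin n) → ℝ, IsKernelL2 s lam Lam K →
      ∀ R : ℝ, 0 < R →
      ∀ E : Set (EuclideanSpace ℝ (Fin n)), MeasureTheory.NullMeasurableSet E →
        IsStableSet K (Metric.ball 0 (4 * R)) E →
        classicalPerimeter (Metric.ball 0 R) E ≤ ENNReal.ofReal (C * R ^ (n - 1)) ∧
        kernelPerimeter K (Metric.ball 0 R) E ≤ ENNReal.ofReal (C * R ^ ((n : ℝ) - s))) ∧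
    (∃ C : ℝ, 0 < C ∧
      ∀ R : ℝ, 0 < R →
      ∀ E : Set (EuclideanSpace ℝ (Fin n)), MeasureTheory.NullMeasurableSet E →
        IsStableSet (fractionalKernel n s) (Metric.ball 0 (2 * R)) E →
        classicalPerimeter (Metric.ball 0 R) E ≤ ENNReal.ofReal (C * R ^ (n - 1)) ∧
        kernelPerimeter (fractionalKernel n s) (Metric.ball 0 R) E
          ≤ ENNReal.ofReal (C * R ^ ((n : ℝ) - s))) := by
  have hn1 : 1 ≤ n := by omega
  constructor
  · intro lam Lam hl
    by_cases hL : 0 < Lam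
    · obtain ⟨C, hC, H⟩ := exists_perimeter_bounds hn1 hs.1 hs.2 hl hL
      refine ⟨C, hC, fun K hK R hR E hE hst => H K hK R (2 * R) hR (by linarith) le_rfl E hE ?_⟩
      rwa [← mul_assoc, show (2 : ℝ) * 2 = 4 by norm_num]
    -- The class is empty when `Lam ≤ 0`, since a nonzero vector forces `lam ≤ Lam`.
    · refine ⟨1, one_pos, fun K hK => ?_⟩
      have hz : (EuclideanSpace.single (⟨0, hn1⟩ : Fin n) (1 : ℝ)) ≠ 0 := by
        rw [← norm_ne_zero_iff]; simp
      exact absurd (hl.trans_le (hK.lam_le_Lam hz)) hL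
  · obtain ⟨C, hC, H⟩ := exists_perimeter_bounds hn1 hs.1 hs.2 one_pos
      (show 0 < ((n : ℝ) + s) * ((n : ℝ) + s + 3) + 1 by have := hs.1; positivity)
    exact ⟨C, hC, fun R hR E hE hst => H _ (isKernelL2_fractionalKernel hs.1) R R hR le_rfl
      (by linarith) E hE hst⟩
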